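/- Let $n\ge 3$ and let $C_n$ be the Hecke--Kiselman monoid of the oriented cycle $1\to 2\to\cdots\to n\to 1$, i.e. the monoid generated by $x_1,\dots,x_n$ (indices modulo $n$) subject to $x_j^2=x_j$ for all $j$, $x_jx_{j+1}x_j=x_{j+1}x_jx_{j+1}=x_jx_{j+1}$ for all $j$, and $x_jx_k=x_kx_j$ whenever $j-k\not\equiv\pm1 \pmod n$. For $0\le i\le n-2$ put $q_i=x_1\cdots x_i\,x_{n-1}x_{n-2}\cdots x_{i+1}$ (so $q_0=x_{n-1}\cdots x_1$), and let $$I_i=\{w\in C_n:\ C_nwC_n\cap\langle x_nq_i\rangle=\emptyset\},$$ where $\langle x_nq_i\rangle$ is the submonoid generated by $x_nq_i$. Let $S$ be the system consisting of the following reductions $(w,v)$ of words in $x_1,\dots,x_n$, where $|u|_k$ denotes the number of occurrences of $x_k$ in $u$: (1) $(x_jx_j,\,x_j)$; (2) $(x_kx_j,\,x_jx_k)$ for $1\le j,k\le n$ with $1<k-j<n-1$; (3) $(x_nx_1\cdots x_jx_k,\ x_kx_nx_1\cdots x_j)$ for $j\ge1$ and $j+1<k<n-1$; (4) $(x_jux_j,\,x_ju)$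 for nonempty $u$ with $|u|_j=|u|_{j-1}=0$; (5) $(x_jux_j,\,ux_j)$ for nonempty $u$ with $|u|_j=|u|_{j+1}=0$ (indices modulo $n$). A word is reduced if it has no factor that is the left-hand side $w$ of a pair $(w,v)\in S$. Let $\tilde M_i\subseteq C_n$ be the set of the elements represented by a reduced word that has the word $x_nq_i$ as a factor. Then for every $i\in\{0,\dots,n-2\}$: (a) for every $w\in C_n$, $(x_nq_i)\,w\,(x_nq_i)\in\{(x_nq_i)^k: k\ge 2\}\cup I_i$; (b) after factoring out $I_i$, the set $\tilde M_i\cup\{\theta\}$, with $\theta$ a new element, is a semigroup: there is exactly one binary operation $\ast$ on it such that $\theta\ast s=s\ast\theta=\theta$ for all $s$ and such that, for all $u,v\in\tilde M_i$, one has $u\ast v=\theta$ if $uv\in I_i$, while if $uv\notin I_i$ then $uv\in\tilde M_i$ and $u\ast v=uv$ (products in $C_n$); and this operation is associative. -/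

import Mathlib

/-- The defining relations of the Hecke--Kiselman monoid of a digraph `Θ` on the vertex set `V`:
every generator is idempotent; generators of non-adjacent vertices commute; an arrow `u → v`
gives `uvu = vuv = uv`; an unoriented edge (arrows in both directions) gives `uvu = vuv`. -/
inductive HKRel {V : Type*} (Θ : Digraph V) : FreeMonoid V → FreeMonoid V → Prop
  | idem (u : V) : HKRel Θ (FreeMonoid.of u * FreeMonoid.of u) (FreeMonoid.of u)
  | comm (u v : V) (huv : ¬ Θ.Adj u v) (hvu : ¬ Θ.Adj v u) :
      HKRel Θ (FreeMonoid.of u * FreeMonoid.of v) (FreeMonoid.of v * FreeMonoid.of u)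
  | arrow_left (u v : V) (huv : Θ.Adj u v) (hvu : ¬ Θ.Adj v u) :
      HKRel Θ (FreeMonoid.of u * FreeMonoid.of v * FreeMonoid.of u)
        (FreeMonoid.of u * FreeMonoid.of v)
  | arrow_right (u v : V) (huv : Θ.Adj u v) (hvu : ¬ Θ.Adj v u) :
      HKRel Θ (FreeMonoid.of v * FreeMonoid.of u * FreeMonoid.of v)
        (FreeMonoid.of u * FreeMonoid.of v)
  | edge (u v : V) (huv : Θ.Adj u v) (hvu : Θ.Adj v u) :
      HKRel Θ (FreeMonoid.of u * FreeMonoid.of v * FreeMonoid.of u)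
        (FreeMonoid.of v * FreeMonoid.of u * FreeMonoid.of v)

/-- The Hecke--Kiselman monoid of a digraph. -/
abbrev HeckeKiselman {V : Type*} (Θ : Digraph V) : Type _ := PresentedMonoid (HKRel Θ)

/-- The oriented cycle `1 → 2 → ⋯ → n → 1`; the vertices `1, …, n` are the residues mod `n`
(so the vertex `n` is the residue `0`). -/
def orientedCycle (n : ℕ) : Digraph (ZMod n) where
  Adj u v := v = u + 1

/-- The monoid `C_n`: the Hecke--Kiselman monoid of the oriented cycle of length `n`. -/
abbrev CycleMonoid (n : ℕ) : Type := HeckeKiselman (orientedCycle n)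

/-- Words in the generators `x_1, …, x_n`; the letter `x_j` is the residue of `j` mod `n`. -/
abbrev CWord (n : ℕ) : Type := List (ZMod n)

/-- The letter `x_j`. -/
def letter (n j : ℕ) : ZMod n := (j : ZMod n)

/-- The element of `C_n` represented by a word. -/
def CWord.toMonoid {n : ℕ} (w : CWord n) : CycleMonoid n :=
  PresentedMonoid.mk (HKRel (orientedCycle n)) (FreeMonoid.ofList w)

/-- The word `x_a x_{a+1} ⋯ x_b`; it is empty if `b < a`. -/
def upWord (n a b : ℕ) : CWord n := (List.range' a (b + 1 - a)).map (letter n)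

/-- The word `x_a x_{a-1} ⋯ x_b`; it is empty if `a < b`. -/
def downWord (n a b : ℕ) : CWord n := (upWord n b a).reverse

/-- The word `x_n q_i`, where `q_i = x_1 ⋯ x_i x_{n-1} ⋯ x_{i+1}` (and `q_0 = x_{n-1} ⋯ x_1`). -/
def xqWord (n i : ℕ) : CWord n := letter n n :: (upWord n 1 i ++ downWord n (n - 1) (i + 1))

/-- The element `x_n q_i` of `C_n`. -/
def xq (n i : ℕ) : CycleMonoid n := (xqWord n i).toMonoid

/-- `I_i = {w ∈ C_n : C_n w C_n ∩ ⟨x_n q_i⟩ = ∅}`, with `⟨x_n q_i⟩` the generated submonoid. -/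
def idealI (n i : ℕ) : Set (CycleMonoid n) :=
  {w | {z | ∃ a b : CycleMonoid n, z = a * w * b} ∩
    (Submonoid.closure {xq n i} : Set (CycleMonoid n)) = ∅}

/-- The system `S` of reductions on words. -/
inductive Reduction (n : ℕ) : CWord n → CWord n → Prop
  | one (i : ZMod n) : Reduction n [i, i] [i]
  | two (i j : ℕ) (hi : 1 ≤ i) (hij : i + 1 < j) (hj : j + 1 < n + i) (hjn : j ≤ n) :
      Reduction n [letter n j, letter n i] [letter n i, letter n j]
  | three (i j : ℕ) (hi : 1 ≤ i) (hij : i + 1 < j) (hj : j < n - 1) :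
      Reduction n (letter n n :: (upWord n 1 i ++ [letter n j]))
        (letter n j :: letter n n :: upWord n 1 i)
  | four (i : ZMod n) (u : CWord n) (hu : u ≠ []) (h : i ∉ u) (h' : i - 1 ∉ u) :
      Reduction n (i :: (u ++ [i])) (i :: u)
  | five (i : ZMod n) (v : CWord n) (hv : v ≠ []) (h : i ∉ v) (h' : i + 1 ∉ v) :
      Reduction n (i :: (v ++ [i])) (v ++ [i])

/-- A word is reduced if no left-hand side of a reduction in `S` is a factor of it. -/
def IsReducedWord {n : ℕ} (w : CWord n) : Prop :=
  ∀ l r : CWord n, Reduction n l r → ¬ l <:+: w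

/-- The set `M̃_i` of those elements of `C_n` whose reduced form has the factor `x_n q_i`. -/
def Mtilde (n i : ℕ) : Set (CycleMonoid n) :=
  {z | ∃ w : CWord n, IsReducedWord w ∧ xqWord n i <:+: w ∧ w.toMonoid = z}

/-- `M̃_i ∪ {θ}`, with `θ` (written `0`) a new element. -/
abbrev MtildeTheta (n i : ℕ) : Type := WithZero (Mtilde n i)

/-- `mul` is the multiplication on `M̃_i ∪ {θ}` obtained from that of `C_n` by factoring out `I_i`:
`θ` is a zero, a product (in `C_n`) of two elements of `M̃_i` that lies in `I_i` becomes `θ`,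
and a product that does not lie in `I_i` lies in `M̃_i` and is left unchanged. -/
structure IsFactorMul (n i : ℕ) (mul : MtildeTheta n i → MtildeTheta n i → MtildeTheta n i) :
    Prop where
  zero_mul : ∀ s, mul 0 s = 0
  mul_zero : ∀ s, mul s 0 = 0
  mul_mem_ideal : ∀ u v : Mtilde n i, (u * v : CycleMonoid n) ∈ idealI n i →
    mul (u : MtildeTheta n i) (v : MtildeTheta n i) = 0
  mul_notMem_ideal : ∀ u v : Mtilde n i, (u * v : CycleMonoid n) ∉ idealI n i →
    ∃ h : (u * v : CycleMonoid n) ∈ Mtilde n i,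
      mul (u : MtildeTheta n i) (v : MtildeTheta n i) =
        ((⟨(u * v : CycleMonoid n), h⟩ : Mtilde n i) : MtildeTheta n i)

/-! ### The action of words on the integers -/

/-! Let `x_a` act on ℤ by moving the integers congruent to `a + 1` one step down. This represents
`C_n` by monotone, non-increasing maps that commute with translation by `n`.

The action is faithful (`toMonoid_eq_of_act_eq`). Reduced words are alternating: between two
successive copies of a letter both neighbouring letters occur. For alternating words the action
determines the last letter up to commutation, and then the action of what precedes it.

Put `f = x_n q_i`. It sends every integer to the largest smaller integer whose residue lies in the
core `{i + 2, …, n}`. So it maps onto the core and is the predecessor map there. Define the rank of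
a map as the number of residues in its image. Rank cannot grow in a product and every power of `f`
has rank at least `n - 1 - i`, so every element outside `I_i` has at least this rank.

For (a), if `f w f ∉ I_i`, rank makes `f w` an order automorphism of the core, which is ordered like
ℤ. It commutes with the predecessor map, hence is a power of `f` on the core, and faithfulness gives
`f w f = f ^ (k + 1)` (`sandwich`).

For (b), let `a f b ∉ I_i` and take a reduced word for it. Following trajectories finds an `x_n`
with all the other letters to its right (`exists_split_letter_mem`). In a reduced word such an `x_n`
starts a factor `x_n q_j` (`IsReducedWord.exists_xqWord`). That factor forces rank exactly `n - 1 -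
j`, while `a f b` has rank `n - 1 - i`, so `j = i` (`mem_Mtilde`). Closure of `M̃_i` modulo `I_i`
follows, and associativity is formal because `I_i` is an ideal. -/

theorem ZMod.one_ne_zero_of_three_le {n : ℕ} (hn : 3 ≤ n) : (1 : ZMod n) ≠ 0 := by
  have h : ¬ ((1 : ℕ) : ZMod n) = 0 := by
    rw [ZMod.natCast_eq_zero_iff]
    exact fun h => by have := Nat.le_of_dvd one_pos h; omega
  simpa using h

theorem ZMod.two_ne_zero_of_three_le {n : ℕ} (hn : 3 ≤ n) : (2 : ZMod n) ≠ 0 := by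
  have h : ¬ ((2 : ℕ) : ZMod n) = 0 := by
    rw [ZMod.natCast_eq_zero_iff]
    exact fun h => by have := Nat.le_of_dvd two_pos h; omega
  simpa using h

/-- The generator `x_a` sends the integers congruent to `a + 1` to their predecessors. -/
def genAct {n : ℕ} (a : ZMod n) (p : ℤ) : ℤ := if (p : ZMod n) = a + 1 then p - 1 else p

/-- The action of a word on the integers; the rightmost letter acts first. -/
def act {n : ℕ} (w : CWord n) (p : ℤ) : ℤ := w.foldr genAct p

section Action
variable {n : ℕ}

@[simp] theorem act_nil (p : ℤ) : act ([] : CWord n) p = p := rfl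

@[simp] theorem act_cons (a : ZMod n) (w : CWord n) (p : ℤ) :
    act (a :: w) p = genAct a (act w p) := rfl

@[simp] theorem act_append (u v : CWord n) (p : ℤ) : act (u ++ v) p = act u (act v p) := by
  simp [act, List.foldr_append]

theorem genAct_le (a : ZMod n) (p : ℤ) : genAct a p ≤ p := by
  unfold genAct; split_ifs <;> omega

theorem genAct_mono (a : ZMod n) {p q : ℤ} (h : p ≤ q) : genAct a p ≤ genAct a q := by
  rcases h.eq_or_lt with rfl | h
  · rfl
  · unfold genAct; split_ifs <;> omega

theorem genAct_add_mul (a : ZMod n) (p t : ℤ) : genAct a (p + n * t) = genAct a p + n * t := by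
  unfold genAct
  have : ((p + n * t : ℤ) : ZMod n) = (p : ZMod n) := by simp
  rw [this]
  split_ifs <;> omega

theorem act_le (w : CWord n) (p : ℤ) : act w p ≤ p := by
  induction w with
  | nil => simp
  | cons a w ih => exact (genAct_le _ _).trans ih

theorem act_mono (w : CWord n) {p q : ℤ} (h : p ≤ q) : act w p ≤ act w q := by
  induction w with
  | nil => simpa
  | cons a w ih => exact genAct_mono _ ih

theorem lt_of_act_lt (w : CWord n) {p q : ℤ} (h : act w p < act w q) : p < q := by
  by_contra! h'
  exact absurd (act_mono w h') (not_le.2 h)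

theorem act_add_mul (w : CWord n) (p t : ℤ) : act w (p + n * t) = act w p + n * t := by
  induction w with
  | nil => simp
  | cons a w ih => rw [act_cons, ih, genAct_add_mul, act_cons]

theorem genAct_idem (hn : 3 ≤ n) (a : ZMod n) (p : ℤ) : genAct a (genAct a p) = genAct a p := by
  have h1 := ZMod.one_ne_zero_of_three_le hn
  unfold genAct
  split_ifs with h h' <;> try rfl
  push_cast at h'
  exact absurd (by linear_combination h - h') h1

theorem genAct_comm {a b : ZMod n} (hab : b ≠ a + 1) (hba : a ≠ b + 1) (p : ℤ) :
    genAct a (genAct b p) = genAct b (genAct a p) := by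
  unfold genAct
  split_ifs with h1 h2 h3 h3 h2 h3 h3 <;> push_cast at * <;> grind

theorem genAct_arrow_left (hn : 3 ≤ n) (a : ZMod n) (p : ℤ) :
    genAct a (genAct (a + 1) (genAct a p)) = genAct a (genAct (a + 1) p) := by
  have h1 := ZMod.one_ne_zero_of_three_le hn
  have h3 : a + 1 ≠ a + 1 + 1 := by simpa using h1
  have h2 := ZMod.two_ne_zero_of_three_le hn
  unfold genAct
  split_ifs <;> push_cast at * <;> grind

theorem genAct_arrow_right (hn : 3 ≤ n) (a : ZMod n) (p : ℤ) :
    genAct (a + 1) (genAct a (genAct (a + 1) p)) = genAct a (genAct (a + 1) p) := by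
  have h1 := ZMod.one_ne_zero_of_three_le hn
  have h2 := ZMod.two_ne_zero_of_three_le hn
  unfold genAct
  split_ifs <;> push_cast at * <;> grind

theorem orientedCycle_asymm (hn : 3 ≤ n) {a b : ZMod n} (h : (orientedCycle n).Adj a b) :
    ¬ (orientedCycle n).Adj b a := by
  have h2 := ZMod.two_ne_zero_of_three_le hn
  simp only [orientedCycle] at h ⊢
  grind

/-- The action of `C_n` on the integers. -/
def cycleAct (hn : 3 ≤ n) : CycleMonoid n →* Function.End ℤ :=
  PresentedMonoid.lift (M := Function.End ℤ) (rels := HKRel (orientedCycle n))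
    (fun a => genAct a) <| by
    intro u v h
    cases h with
    | idem a =>
      simp only [map_mul]
      funext p
      exact genAct_idem hn a p
    | comm a b hab hba =>
      simp only [map_mul]
      funext p
      exact genAct_comm hab hba p
    | arrow_left a b hab hba =>
      obtain rfl : b = a + 1 := hab
      simp only [map_mul]
      funext p
      exact genAct_arrow_left hn a p
    | arrow_right a b hab hba =>
      obtain rfl : b = a + 1 := hab
      simp only [map_mul]
      funext p
      exact genAct_arrow_right hn a p
    | edge a b hab hba => exact absurd hba (orientedCycle_asymm hn hab)

theorem toMonoid_append (u v : CWord n) : CWord.toMonoid (u ++ v) = u.toMonoid * v.toMonoid := by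
  simp [CWord.toMonoid]

/-- The generator `x_a` of `C_n`. -/
def gen (a : ZMod n) : CycleMonoid n := CWord.toMonoid [a]

theorem toMonoid_nil : CWord.toMonoid ([] : CWord n) = 1 := by
  simp [CWord.toMonoid]

theorem toMonoid_cons (a : ZMod n) (v : CWord n) :
    CWord.toMonoid (a :: v) = gen a * v.toMonoid :=
  toMonoid_append [a] v

theorem toMonoid_append_singleton (v : CWord n) (a : ZMod n) :
    CWord.toMonoid (v ++ [a]) = v.toMonoid * gen a :=
  toMonoid_append v [a]

theorem toMonoid_surjective : Function.Surjective (CWord.toMonoid (n := n)) := by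
  intro z
  obtain ⟨w, rfl⟩ := PresentedMonoid.surjective_mk z
  exact ⟨FreeMonoid.toList w, rfl⟩

theorem cycleAct_toMonoid (hn : 3 ≤ n) (w : CWord n) (p : ℤ) :
    cycleAct hn w.toMonoid p = act w p := by
  induction w generalizing p with
  | nil => rw [toMonoid_nil, map_one]; rfl
  | cons a w ih =>
    rw [toMonoid_cons, map_mul]
    change cycleAct hn (gen a) (cycleAct hn (CWord.toMonoid w) p) = _
    rw [ih]
    rfl

theorem act_eq_of_toMonoid_eq (hn : 3 ≤ n) {u v : CWord n} (h : u.toMonoid = v.toMonoid) (p : ℤ) :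
    act u p = act v p := by
  rw [← cycleAct_toMonoid hn, ← cycleAct_toMonoid hn, h]

/-! ### Relations between words in `C_n` -/

theorem gen_mul_self (a : ZMod n) : gen a * gen a = gen a := by
  rw [gen, ← toMonoid_append]
  exact PresentedMonoid.mk_eq_mk_of_rel (HKRel.idem a)

theorem gen_mul_comm {a b : ZMod n} (hab : b ≠ a + 1) (hba : a ≠ b + 1) :
    gen a * gen b = gen b * gen a := by
  rw [gen, gen, ← toMonoid_append, ← toMonoid_append]
  exact PresentedMonoid.mk_eq_mk_of_rel (HKRel.comm a b hab hba)

theorem gen_arrow_left (hn : 3 ≤ n) (a : ZMod n) :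
    gen a * gen (a + 1) * gen a = gen a * gen (a + 1) := by
  have h : (orientedCycle n).Adj a (a + 1) := rfl
  simp only [gen, ← toMonoid_append]
  exact PresentedMonoid.mk_eq_mk_of_rel (HKRel.arrow_left a (a + 1) h (orientedCycle_asymm hn h))

theorem gen_arrow_right (hn : 3 ≤ n) (a : ZMod n) :
    gen (a + 1) * gen a * gen (a + 1) = gen a * gen (a + 1) := by
  have h : (orientedCycle n).Adj a (a + 1) := rfl
  simp only [gen, ← toMonoid_append]
  exact PresentedMonoid.mk_eq_mk_of_rel (HKRel.arrow_right a (a + 1) h (orientedCycle_asymm hn h))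

/-- A letter commutes with a word none of whose letters is adjacent to it. -/
theorem gen_mul_toMonoid_comm {a : ZMod n} {u : CWord n} (h : a - 1 ∉ u) (h' : a + 1 ∉ u) :
    gen a * u.toMonoid = u.toMonoid * gen a := by
  induction u with
  | nil => rw [toMonoid_nil, one_mul, mul_one]
  | cons b u ih =>
    simp only [List.mem_cons, not_or] at h h'
    rw [toMonoid_cons b u, ← mul_assoc, gen_mul_comm, mul_assoc, ih h.2 h'.2, mul_assoc]
    · exact fun e => h'.1 e.symm
    · exact fun e => h.1 (by rw [e]; ring)

/-- The left copy of `a` travels through `u`: it commutes with every letter except `a + 1`, and at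
`a + 1` the relation `a (a+1) = a (a+1) a` lets it leave a copy behind and go on. The travelling
copy finally absorbs the right one. -/
theorem toMonoid_absorb_right (hn : 3 ≤ n) {a : ZMod n} {u : CWord n} (h : a ∉ u)
    (h' : a - 1 ∉ u) : gen a * u.toMonoid * gen a = gen a * u.toMonoid := by
  induction u with
  | nil => simp only [toMonoid_nil, mul_one, gen_mul_self]
  | cons b u ih =>
    simp only [List.mem_cons, not_or] at h h'
    have ih := ih h.2 h'.2
    rw [toMonoid_cons b]
    by_cases hb : b = a + 1
    · subst hb
      have key := gen_arrow_left hn a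
      rw [← mul_assoc, ← key, mul_assoc (gen a * gen (a + 1)), mul_assoc (gen a * gen (a + 1)),
        ih]
    · have key := gen_mul_comm (a := a) (b := b) hb (fun e => h'.1 (by rw [e]; ring))
      rw [← mul_assoc, key, mul_assoc (gen b), mul_assoc (gen b), ih]

/-- Mirror image: the right copy travels leftwards, duplicated at `a - 1`. -/
theorem toMonoid_absorb_left (hn : 3 ≤ n) {a : ZMod n} {u : CWord n} (h : a ∉ u)
    (h' : a + 1 ∉ u) : gen a * u.toMonoid * gen a = u.toMonoid * gen a := by
  induction u using List.reverseRecOn with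
  | nil => simp only [toMonoid_nil, mul_one, one_mul, gen_mul_self]
  | append_singleton u b ih =>
    simp only [List.mem_append, List.mem_singleton, not_or] at h h'
    have ih := ih h.1 h'.1
    rw [toMonoid_append_singleton]
    by_cases hb : b = a - 1
    · obtain rfl : a = b + 1 := by rw [hb]; ring
      have key := gen_arrow_right hn b
      rw [mul_assoc, mul_assoc (CWord.toMonoid u), ← key]
      simp only [← mul_assoc]
      rw [ih]
    · have key := gen_mul_comm (a := a) (b := b) (fun e => h'.2 e.symm)
        (fun e => hb (by rw [e]; ring))
      rw [mul_assoc, mul_assoc (CWord.toMonoid u), ← key]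
      simp only [← mul_assoc]
      rw [ih]

end Action

/-! ### Letters numbered by `1, …, n`, and ascending and descending words. -/

section Letters
variable {n : ℕ}

theorem letter_ne_of_lt {a b : ℕ} (h : a < b) (h' : b < a + n) : letter n a ≠ letter n b := by
  unfold letter
  intro e
  rw [ZMod.natCast_eq_natCast_iff] at e
  have := (Nat.modEq_iff_dvd' h.le).1 e
  have := Nat.le_of_dvd (by omega) this
  omega

theorem letter_inj {a b : ℕ} (ha : 1 ≤ a) (ha' : a ≤ n) (hb : 1 ≤ b) (hb' : b ≤ n)
    (h : letter n a = letter n b) : a = b := by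
  rcases lt_trichotomy a b with h1 | h1 | h1
  · exact absurd h (letter_ne_of_lt h1 (by omega))
  · exact h1
  · exact absurd h.symm (letter_ne_of_lt h1 (by omega))

theorem letter_add_one (a : ℕ) : letter n a + 1 = letter n (a + 1) := by
  simp [letter]

theorem letter_sub_one {a : ℕ} (h : 1 ≤ a) : letter n a - 1 = letter n (a - 1) := by
  simp [letter, Nat.cast_sub h]

theorem letter_zero : letter n 0 = letter n n := by
  simp [letter]

theorem exists_letter (hn : 3 ≤ n) (a : ZMod n) : ∃ t, 1 ≤ t ∧ t ≤ n ∧ a = letter n t := by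
  have : NeZero n := ⟨by omega⟩
  rcases Nat.eq_zero_or_pos a.val with h | h
  · refine ⟨n, by omega, le_rfl, ?_⟩
    rw [← letter_zero, letter, ← h, ZMod.natCast_zmod_val]
  · refine ⟨a.val, h, (ZMod.val_lt a).le, ?_⟩
    rw [letter, ZMod.natCast_zmod_val]

theorem mem_upWord {a b : ℕ} {c : ZMod n} :
    c ∈ upWord n a b ↔ ∃ t, a ≤ t ∧ t ≤ b ∧ c = letter n t := by
  simp only [upWord, List.mem_map, List.mem_range'_1]
  constructor
  · rintro ⟨t, h, rfl⟩; exact ⟨t, by omega, by omega, rfl⟩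
  · rintro ⟨t, h, h', rfl⟩; exact ⟨t, by omega, rfl⟩

theorem upWord_append {a b c : ℕ} (h : a ≤ b + 1) (h' : b ≤ c) :
    upWord n a c = upWord n a b ++ upWord n (b + 1) c := by
  rw [upWord, upWord, upWord, ← List.map_append]
  congr 1
  have := List.range'_append_1 (s := a) (m := b + 1 - a) (n := c + 1 - (b + 1))
  rw [show a + (b + 1 - a) = b + 1 by omega] at this
  rw [this]
  congr 1; omega

theorem upWord_self (a : ℕ) : upWord n a a = [letter n a] := by
  simp [upWord]

theorem upWord_of_lt {a b : ℕ} (h : b < a) : upWord n a b = [] := by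
  simp [upWord, Nat.sub_eq_zero_of_le (show b + 1 ≤ a by omega)]

theorem upWord_succ_right {a b : ℕ} (h : a ≤ b + 1) :
    upWord n a (b + 1) = upWord n a b ++ [letter n (b + 1)] := by
  rw [upWord_append h (by omega), upWord_self]

theorem upWord_split {a k b : ℕ} (h : a ≤ k) (h' : k ≤ b) (ha : 1 ≤ a) :
    upWord n a b = upWord n a (k - 1) ++ letter n k :: upWord n (k + 1) b := by
  obtain ⟨k, rfl⟩ : ∃ m, k = m + 1 := ⟨k - 1, by omega⟩
  rw [upWord_append (b := k + 1) (by omega) h', upWord_succ_right h]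
  simp

theorem downWord_of_lt {a b : ℕ} (h : b < a) : downWord n b a = [] := by
  simp [downWord, upWord_of_lt h]

theorem downWord_split {a k b : ℕ} (h : a ≤ k) (h' : k ≤ b) (ha : 1 ≤ a) :
    downWord n b a = downWord n b (k + 1) ++ letter n k :: downWord n (k - 1) a := by
  simp [downWord, upWord_split h h' ha]

theorem downWord_succ_left {a b : ℕ} (h : a ≤ b + 1) :
    downWord n (b + 1) a = letter n (b + 1) :: downWord n b a := by
  simp [downWord, upWord_succ_right h]

theorem downWord_succ_right {a b : ℕ} (h : a ≤ b) (ha : 1 ≤ a) :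
    downWord n b a = downWord n b (a + 1) ++ [letter n a] := by
  rw [downWord_split le_rfl h ha, downWord_of_lt (b := a - 1) (by omega)]

end Letters

/-! ### Reduced words -/

section Reduced
variable {n : ℕ}

theorem Reduction.toMonoid_eq (hn : 3 ≤ n) {l r : CWord n} (h : Reduction n l r) :
    l.toMonoid = r.toMonoid := by
  cases h with
  | one i => simp only [toMonoid_cons, toMonoid_nil, mul_one, gen_mul_self]
  | two i j hi hij hj hjn =>
    simp only [toMonoid_cons, toMonoid_nil, mul_one]
    refine gen_mul_comm ?_ ?_
    · rw [letter_add_one]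
      rcases lt_or_eq_of_le hjn with h | rfl
      · exact letter_ne_of_lt (by omega) (by omega)
      · rw [← letter_add_one, ← letter_zero, letter_add_one]
        exact (letter_ne_of_lt (by omega) (by omega)).symm
    · rw [letter_add_one]
      exact (letter_ne_of_lt hij (by omega)).symm
  | three i j hi hij hj =>
    rw [toMonoid_cons (letter n j), gen_mul_toMonoid_comm, ← toMonoid_append_singleton,
      List.cons_append]
    · rw [letter_sub_one (by omega)]
      simp only [List.mem_cons, mem_upWord, not_or, not_exists, not_and]
      exact ⟨letter_ne_of_lt (by omega) (by omega),
        fun t h h' => (letter_ne_of_lt (by omega) (by omega)).symm⟩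
    · rw [letter_add_one]
      simp only [List.mem_cons, mem_upWord, not_or, not_exists, not_and]
      exact ⟨letter_ne_of_lt (by omega) (by omega),
        fun t h h' => (letter_ne_of_lt (by omega) (by omega)).symm⟩
  | four i u hu h h' =>
    rw [toMonoid_cons, toMonoid_append_singleton, ← mul_assoc, toMonoid_absorb_right hn h h',
      toMonoid_cons]
  | five i u hu h hsucc =>
    rw [toMonoid_cons, toMonoid_append_singleton, ← mul_assoc, toMonoid_absorb_left hn h hsucc]

/-- The index in `1, …, n` of a letter. -/
def letterIndex (a : ZMod n) : ℕ := if a = 0 then n else a.val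

theorem letterIndex_letter {t : ℕ} (h : 1 ≤ t) (h' : t ≤ n) : letterIndex (letter n t) = t := by
  unfold letterIndex
  rcases lt_or_eq_of_le h' with h1 | rfl
  · have h2 : letter n t ≠ 0 := by
      have := letter_ne_of_lt (n := n) (a := 0) (b := t) (by omega) (by omega)
      simpa [letter] using this.symm
    rw [if_neg h2, letter, ZMod.val_natCast_of_lt h1]
  · rw [if_pos]; simp [letter]

theorem letterIndex_le (hn : 3 ≤ n) (a : ZMod n) : letterIndex a ≤ n := by
  obtain ⟨t, h, htn, rfl⟩ := exists_letter hn a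
  rwa [letterIndex_letter h htn]

/-- The value of a word, read as a numeral in base `n + 1`. -/
def wordValue : CWord n → ℕ
  | [] => 0
  | a :: w => letterIndex a * (n + 1) ^ w.length + wordValue w

theorem wordValue_append (u v : CWord n) :
    wordValue (u ++ v) = wordValue u * (n + 1) ^ v.length + wordValue v := by
  induction u with
  | nil => simp [wordValue]
  | cons a u ih =>
    simp only [List.cons_append, wordValue, ih, List.length_append, pow_add]
    ring

theorem wordValue_lt (hn : 3 ≤ n) (w : CWord n) : wordValue w < (n + 1) ^ w.length := by
  induction w with
  | nil => simp [wordValue]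
  | cons a w ih =>
    simp only [wordValue, List.length_cons, pow_succ]
    have := Nat.mul_le_mul_right ((n + 1) ^ w.length) (letterIndex_le hn a)
    nlinarith

/-- Shortlex descent: (1), (4), (5) shorten the word, while (2) and (3) keep the length and put a
smaller letter first, which decides a numeral in base `n + 1`. -/
theorem Reduction.decreasing (hn : 3 ≤ n) {l r : CWord n} (h : Reduction n l r) :
    r.length < l.length ∨ r.length = l.length ∧ wordValue r < wordValue l := by
  cases h with
  | one i => left; simp
  | two i j hi hij hj hjn =>
    right
    simp only [List.length_cons, wordValue, letterIndex_letter hi (by omega : i ≤ n),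
      letterIndex_letter (by omega : 1 ≤ j) hjn]
    simp only [List.length_nil, true_and, zero_add, pow_one, pow_zero, mul_one, add_zero]
    have : i * n < j * n := Nat.mul_lt_mul_of_pos_right (by omega) (by omega)
    linarith
  | three i j hi hij hj =>
    right
    have h1 := wordValue_lt hn (letter n n :: upWord n 1 i)
    simp only [wordValue, List.length_cons, List.length_append, List.length_nil] at h1 ⊢
    rw [letterIndex_letter (by omega : 1 ≤ n) le_rfl] at h1 ⊢
    rw [letterIndex_letter (by omega : 1 ≤ j) (by omega)]
    refine ⟨trivial, ?_⟩
    have h3 : (j + 1) * (n + 1) ^ ((upWord n 1 i).length + 1)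
      ≤ n * (n + 1) ^ ((upWord n 1 i).length + 1) := Nat.mul_le_mul_right _ (by omega)
    simp only [zero_add] at *
    nlinarith
  | four i u hu h h' => left; simp
  | five i u hu h h' => left; simp

/-- Every element of `C_n` is represented by a reduced word. -/
theorem exists_reducedWord (hn : 3 ≤ n) (z : CycleMonoid n) :
    ∃ w : CWord n, IsReducedWord w ∧ w.toMonoid = z := by
  obtain ⟨w₀, hw₀⟩ := toMonoid_surjective z
  have wf : WellFounded (InvImage (Prod.Lex (· < ·) (· < ·))
      (fun w : CWord n => (w.length, wordValue w))) :=
    InvImage.wf _ (WellFounded.prod_lex wellFounded_lt wellFounded_lt)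
  -- A shortlex-least representative is reduced, since any reduction inside it would give a smaller
  -- one.
  obtain ⟨w, hw, hmin⟩ := wf.has_min {w : CWord n | w.toMonoid = z} ⟨w₀, hw₀⟩
  refine ⟨w, ?_, hw⟩
  rintro l r h ⟨x, y, rfl⟩
  refine hmin (x ++ r ++ y) ?_ ?_
  · rw [Set.mem_ofPred_eq, ← Set.mem_ofPred.1 hw]
    simp only [toMonoid_append, h.toMonoid_eq hn]
  · simp only [InvImage, Prod.lex_def, List.length_append, wordValue_append]
    rcases h.decreasing hn with h1 | ⟨h1, h2⟩
    · left; omega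
    · right
      refine ⟨by omega, ?_⟩
      rw [h1]
      gcongr

theorem IsReducedWord.of_isInfix {u w : CWord n} (h : IsReducedWord w) (hu : u <:+: w) :
    IsReducedWord u := fun l r hr hl => h l r hr (hl.trans hu)

/-- In a reduced word both neighbours of a letter occur between two successive occurrences. -/
theorem IsReducedWord.mem_between {w : CWord n} (h : IsReducedWord w) {a : ZMod n} {u : CWord n}
    (hw : a :: (u ++ [a]) <:+: w) (ha : a ∉ u) : a - 1 ∈ u ∧ a + 1 ∈ u := by
  have hu : u ≠ [] := by
    rintro rfl
    exact h _ _ (Reduction.one a) hw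
  by_contra! hcon
  by_cases h1 : a - 1 ∈ u
  · exact h _ _ (Reduction.five a u hu ha (hcon h1)) hw
  · exact h _ _ (Reduction.four a u hu ha h1) hw

/-! ### Alternating words -/

/-- The subword of the letters `a` and `a + 1`. -/
def pairFilter (a : ZMod n) (w : CWord n) : CWord n := w.filter (fun b => b = a ∨ b = a + 1)

theorem pairFilter_append (a : ZMod n) (u v : CWord n) :
    pairFilter a (u ++ v) = pairFilter a u ++ pairFilter a v := List.filter_append ..

theorem pairFilter_cons_of_mem {a b : ZMod n} (h : b = a ∨ b = a + 1) (v : CWord n) :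
    pairFilter a (b :: v) = b :: pairFilter a v := by
  simp [pairFilter, h]

theorem pairFilter_cons_of_not_mem {a b : ZMod n} (h : ¬ (b = a ∨ b = a + 1)) (v : CWord n) :
    pairFilter a (b :: v) = pairFilter a v := by
  simp [pairFilter, h]

theorem pairFilter_eq_nil {a : ZMod n} {v : CWord n} (h : a ∉ v) (h' : a + 1 ∉ v) :
    pairFilter a v = [] := by
  rw [pairFilter, List.filter_eq_nil_iff]
  rintro b hb
  simp only [decide_eq_true_eq, not_or]
  exact ⟨fun e => h (e ▸ hb), fun e => h' (e ▸ hb)⟩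

/-- A word in which, for every `a`, the letters `a` and `a + 1` occur alternately. -/
def IsAlternating (w : CWord n) : Prop := ∀ a : ZMod n, (pairFilter a w).IsChain (· ≠ ·)

theorem IsAlternating.of_isInfix {u w : CWord n} (h : IsAlternating w) (hu : u <:+: w) :
    IsAlternating u := by
  obtain ⟨s, t, rfl⟩ := hu
  intro a
  have := h a
  rw [pairFilter_append, pairFilter_append] at this
  exact this.left_of_append.right_of_append

theorem IsAlternating.left {u v : CWord n} (h : IsAlternating (u ++ v)) : IsAlternating u :=
  h.of_isInfix (List.prefix_append u v).isInfix

theorem IsAlternating.right {u v : CWord n} (h : IsAlternating (u ++ v)) : IsAlternating v :=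
  h.of_isInfix (List.suffix_append u v).isInfix

theorem IsAlternating.add_one_mem {u v w : CWord n} {a : ZMod n}
    (h : IsAlternating (u ++ a :: (v ++ a :: w))) (ha : a ∉ v) : a + 1 ∈ v := by
  by_contra h'
  have := h.right a
  rw [pairFilter_cons_of_mem (.inl rfl), pairFilter_append, pairFilter_eq_nil ha h',
    pairFilter_cons_of_mem (.inl rfl)] at this
  simp at this

theorem IsAlternating.sub_one_mem {u v w : CWord n} {a : ZMod n}
    (h : IsAlternating (u ++ a :: (v ++ a :: w))) (ha : a ∉ v) : a - 1 ∈ v := by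
  obtain ⟨b, rfl⟩ : ∃ b, a = b + 1 := ⟨a - 1, by ring⟩
  rw [add_sub_cancel_right]
  by_contra h'
  have := h.right b
  rw [pairFilter_cons_of_mem (.inr rfl), pairFilter_append, pairFilter_eq_nil h' ha,
    pairFilter_cons_of_mem (.inr rfl)] at this
  simp at this

/-- Two equal adjacent letters of the filtered word would be successive occurrences with the other
letter of the pair missing between them, contrary to `IsReducedWord.mem_between`. -/
theorem IsReducedWord.isAlternating {w : CWord n} (h : IsReducedWord w) : IsAlternating w := by
  intro a
  induction w with
  | nil => simp [pairFilter]
  | cons c t ih =>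
    have ih := ih (h.of_isInfix (List.suffix_cons c t).isInfix)
    by_cases hc : c = a ∨ c = a + 1
    · rw [pairFilter_cons_of_mem hc]
      refine List.isChain_cons.2 ⟨?_, ih⟩
      rintro b hb rfl
      obtain ⟨s, hs⟩ : ∃ s, pairFilter a t = c :: s := by
        cases hp : pairFilter a t with
        | nil => rw [hp] at hb; simp at hb
        | cons d s => rw [hp] at hb; simp at hb; exact ⟨s, by rw [hb]⟩
      rw [pairFilter, List.filter_eq_cons_iff] at hs
      obtain ⟨u, v, rfl, hu, -, -⟩ := hs
      simp only [decide_eq_true_eq, not_or] at hu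
      have hcu : c ∉ u := fun hm => by
        have := hu c hm
        tauto
      have := h.mem_between (a := c) (u := u) ⟨[], v, by simp⟩ hcu
      rcases hc with rfl | rfl
      · exact (hu _ this.2).2 rfl
      · exact (hu _ this.1).1 (by ring)
    · rwa [pairFilter_cons_of_not_mem hc]

end Reduced

/-! ### Trajectories of integers under alternating words. -/

section Trajectories
variable {n : ℕ}

theorem List.exists_split_last {α : Type*} {a : α} {w : List α} (h : a ∈ w) :
    ∃ u v, w = u ++ a :: v ∧ a ∉ v := by
  obtain ⟨v, u, e, hv⟩ := List.eq_append_cons_of_mem (List.mem_reverse.2 h)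
  refine ⟨u.reverse, v.reverse, ?_, by simpa using hv⟩
  rw [← List.reverse_reverse w, e]; simp

theorem genAct_self (s : ℤ) : genAct (s : ZMod n) (s + 1) = s := by
  simp [genAct]

theorem genAct_of_ne {a : ZMod n} {p : ℤ} (h : (p : ZMod n) ≠ a + 1) : genAct a p = p :=
  if_neg h

theorem genAct_cast_self (hn : 3 ≤ n) (s : ℤ) : genAct (s : ZMod n) s = s :=
  genAct_of_ne (by simpa using ZMod.one_ne_zero_of_three_le hn)

theorem genAct_cast_add_two (hn : 3 ≤ n) (s : ℤ) : genAct (s : ZMod n) (s + 2) = s + 2 := by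
  refine genAct_of_ne ?_
  have := ZMod.one_ne_zero_of_three_le hn
  push_cast
  intro h
  exact this (by linear_combination h)

theorem sub_one_le_genAct (a : ZMod n) (p : ℤ) : p - 1 ≤ genAct a p := by
  unfold genAct; split_ifs <;> omega

theorem act_eq_self {w : CWord n} {s : ℤ} (h : (s : ZMod n) ∉ w) : act w (s + 1) = s + 1 := by
  induction w with
  | nil => rfl
  | cons a w ih =>
    simp only [List.mem_cons, not_or] at h
    rw [act_cons, ih h.2]
    exact genAct_of_ne (by push_cast; simpa using h.1)

theorem lt_act_of_not_mem {w : CWord n} {s p : ℤ} (h : (s : ZMod n) ∉ w) (hp : s < p) :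
    s < act w p := by
  have h1 := act_mono w (show s + 1 ≤ p from hp)
  rw [act_eq_self h] at h1
  omega

theorem act_le_of_mem {w : CWord n} {s : ℤ} (h : (s : ZMod n) ∈ w) : act w (s + 1) ≤ s := by
  obtain ⟨u, v, rfl, hv⟩ := List.exists_split_last h
  rw [act_append, act_cons, act_eq_self hv, genAct_self]
  exact act_le u s

/-- The set of letters of a word can thus be read off its action. -/
theorem mem_iff_act_le {w : CWord n} {s : ℤ} : (s : ZMod n) ∈ w ↔ act w (s + 1) ≤ s :=
  ⟨act_le_of_mem, fun h => by
    by_contra h'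
    rw [act_eq_self h'] at h
    omega⟩

theorem mem_of_act_le {w : CWord n} {s p : ℤ} (hp : s < p) (h : act w p ≤ s) :
    (s : ZMod n) ∈ w :=
  mem_iff_act_le.2 ((act_mono w hp).trans h)

/-- Neighbouring points are merged if the letter of the right one occurs first. -/
theorem act_eq_act_add_one (hn : 3 ≤ n) {u v : CWord n} {s : ℤ} (h : (s : ZMod n) ∉ v)
    (h' : (s : ZMod n) - 1 ∉ v) :
    act (u ++ (s : ZMod n) :: v) s = act (u ++ (s : ZMod n) :: v) (s + 1) := by
  have e : act v s = s := by
    have := act_eq_self (w := v) (s := s - 1) (by push_cast; exact h')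
    simpa using this
  rw [act_append, act_cons, e, act_append, act_cons, act_eq_self h, genAct_self,
    genAct_cast_self hn]

/-- In an alternating word, a point that has just been moved is never reached by a later one. -/
theorem IsAlternating.act_lt_act {u : CWord n} : ∀ {v : CWord n} {s q : ℤ},
    IsAlternating (u ++ (v ++ [(s : ZMod n)])) → (s : ZMod n) ∉ v → (s : ZMod n) - 1 ∉ v → s < q →
    act u s < act u q := by
  induction u using List.reverseRecOn with
  | nil => intro v s q _ _ _ h; simpa using h
  | append_singleton u c ih =>
    intro v s q hw hv hv' hq
    -- Here `v` only records the letters read since the point arrived at `s`. The next letter `c`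
    -- cannot be `s` by alternation, so a point at `s + 1` cannot step onto `s`. If `c = s - 1` the
    -- point moves and the record restarts.
    rw [act_append, act_append, act_cons, act_cons, act_nil, act_nil]
    rw [List.append_assoc] at hw
    have hc : c ≠ s := by
      rintro rfl
      exact hv' (IsAlternating.sub_one_mem (u := u) (v := v) (w := []) hw hv)
    by_cases hc' : c = (s : ZMod n) - 1
    · have e : genAct c s = s - 1 := by simp [genAct, hc']
      rw [e]
      refine ih (v := []) (s := s - 1) ?_ (by simp) (by simp) ?_
      · refine hw.of_isInfix ⟨[], v ++ [(s : ZMod n)], ?_⟩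
        simp [hc']
      · have := sub_one_le_genAct c q
        omega
    · have e : genAct c s = s := genAct_of_ne (fun h => hc' (by rw [h]; ring))
      rw [e]
      refine ih (v := c :: v) (s := s) (by simpa using hw) ?_ ?_ ?_
      · simpa using ⟨Ne.symm hc, hv⟩
      · simpa using ⟨fun h => hc' h.symm, hv'⟩
      · rcases eq_or_ne q (s + 1) with rfl | h
        · rw [genAct_of_ne]
          · omega
          · push_cast
            simpa using hc.symm
        · have := sub_one_le_genAct c q
          omega

/-- Counterpart of `act_eq_act_add_one`: `s + 1` steps to `s` while `s + 2` is still in place, and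
from then on `IsAlternating.act_lt_act` keeps the two apart. -/
theorem IsAlternating.act_add_one_lt (hn : 3 ≤ n) {u v : CWord n} {s : ℤ}
    (hw : IsAlternating (u ++ (s : ZMod n) :: v)) (h : (s : ZMod n) ∉ v)
    (h' : (s : ZMod n) + 1 ∉ v) :
    act (u ++ (s : ZMod n) :: v) (s + 1) < act (u ++ (s : ZMod n) :: v) (s + 2) := by
  have e : act v (s + 2) = s + 2 := by
    have := act_eq_self (w := v) (s := s + 1) (by push_cast; exact h')
    rwa [add_assoc] at this
  simp only [act_append, act_cons, e, act_eq_self h, genAct_self, genAct_cast_add_two hn]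
  refine IsAlternating.act_lt_act (v := []) ?_ (by simp) (by simp) (by omega)
  exact hw.of_isInfix ⟨[], v, by simp⟩

/-- A point is in the image if its letter occurs last among the letters of itself and its
predecessor. -/
theorem IsAlternating.exists_act_eq (hn : 3 ≤ n) {u v : CWord n} {s : ℤ}
    (hw : IsAlternating (u ++ (s : ZMod n) :: v)) (h : (s : ZMod n) - 1 ∉ u) :
    ∃ p, act (u ++ (s : ZMod n) :: v) p = s := by
  suffices ∃ p, act ((s : ZMod n) :: v) p = s by
    obtain ⟨p, hp⟩ := this
    refine ⟨p, ?_⟩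
    rw [act_append, hp]
    have := act_eq_self (w := u) (s := s - 1) (by push_cast; exact h)
    simpa using this
  -- If `s` occurs again, alternation puts an `s + 1` before the next `s`. Its first occurrence
  -- satisfies the same hypothesis, so `s + 1` is reached there, and the leading letter `s` moves it
  -- to `s`.
  by_cases hs : (s : ZMod n) ∈ v
  · obtain ⟨v₁, v₂, rfl, hv₁⟩ := List.eq_append_cons_of_mem hs
    have h1 : (s : ZMod n) + 1 ∈ v₁ := hw.add_one_mem (v := v₁) (w := v₂) hv₁
    obtain ⟨u', u'', rfl, -⟩ := List.eq_append_cons_of_mem h1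
    have ih := IsAlternating.exists_act_eq hn (u := u') (s := s + 1)
      (v := u'' ++ (s : ZMod n) :: v₂) ?_ ?_
    · obtain ⟨p, hp⟩ := ih
      refine ⟨p, ?_⟩
      rw [act_cons]
      simp only [Int.cast_add, Int.cast_one] at hp
      rw [List.append_assoc, List.cons_append, hp, genAct_self]
    · refine hw.of_isInfix ⟨u ++ [(s : ZMod n)], [], ?_⟩
      simp
    · simp only [List.mem_append, not_or] at hv₁
      simpa using hv₁.1
  · exact ⟨s + 1, by rw [act_cons, act_eq_self hs, genAct_self]⟩
termination_by v.length
decreasing_by subst_vars; simp; omega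

end Trajectories

/-! ### Faithfulness of the action -/

section Faithful
variable {n : ℕ}

/-- The last letter of an alternating word commutes to the end of every alternating word with the
same action. -/
theorem IsAlternating.exists_split_of_act_eq (hn : 3 ≤ n) {v w : CWord n} {a : ZMod n}
    (hv : IsAlternating (v ++ [a])) (hw : IsAlternating w)
    (h : ∀ p, act (v ++ [a]) p = act w p) :
    ∃ u₁ u₂, w = u₁ ++ a :: u₂ ∧ a ∉ u₂ ∧ a - 1 ∉ u₂ ∧ a + 1 ∉ u₂ := by
  obtain ⟨s, rfl⟩ := ZMod.intCast_surjective a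
  have hs : (s : ZMod n) ∈ w := by
    rw [mem_iff_act_le, ← h, ← mem_iff_act_le]; simp
  obtain ⟨u₁, u₂, rfl, hu₂⟩ := List.exists_split_last hs
  refine ⟨u₁, u₂, rfl, hu₂, ?_, ?_⟩
  -- If `s - 1` came after the last `s` in `w`, then `w` would separate `s` and `s + 1`, which `v ++
  -- [s]` merges.
  · intro hm
    obtain ⟨x, y, rfl, hy⟩ := List.exists_split_last hm
    simp only [List.mem_append, List.mem_cons, not_or] at hu₂
    have h1 := act_eq_act_add_one hn (u := v) (v := []) (s := s) (by simp) (by simp)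
    rw [h, h] at h1
    have h2 := IsAlternating.act_add_one_lt hn (u := u₁ ++ (s : ZMod n) :: x) (v := y) (s := s - 1)
      (by simpa using hw) (by simpa using hy) (by simpa using hu₂.2.2)
    simp only [Int.cast_sub, Int.cast_one, sub_add_cancel, List.append_assoc,
      List.cons_append] at h2
    rw [h1, show s - 1 + 2 = s + 1 by ring] at h2
    exact lt_irrefl _ h2
  -- If `s + 1` came after the last `s` in `w`, then `w` would merge `s + 1` and `s + 2`, which `v
  -- ++ [s]` separates.
  · intro hm
    obtain ⟨x, y, rfl, hy⟩ := List.exists_split_last hm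
    simp only [List.mem_append, List.mem_cons, not_or] at hu₂
    have h1 := IsAlternating.act_add_one_lt hn hv (by simp) (by simp)
    rw [h, h] at h1
    have h2 := act_eq_act_add_one hn (u := u₁ ++ (s : ZMod n) :: x) (v := y) (s := s + 1)
      (by simpa using hy) (by simpa using hu₂.2.2)
    simp only [Int.cast_add, Int.cast_one, List.append_assoc,
      List.cons_append] at h2
    rw [h2, show s + 1 + 1 = s + 2 by ring] at h1
    exact lt_irrefl _ h1

/-- The action of an alternating word `v` is determined by that of `v ++ [a]`. -/
theorem IsAlternating.act_add_one_eq (hn : 3 ≤ n) {v : CWord n} {s : ℤ}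
    (hv : IsAlternating (v ++ [(s : ZMod n)])) :
    act v (s + 1) = if act v (s + 2) ≤ s then act v (s + 2) else s + 1 := by
  by_cases hs : (s : ZMod n) ∈ v
  · obtain ⟨x, y, rfl, hy⟩ := List.exists_split_last hs
    -- Alternation with the final letter `s` forces an `s + 1` after the last `s` of `v`, so `v`
    -- merges `s + 1` and `s + 2`.
    have h1 : (s : ZMod n) + 1 ∈ y := IsAlternating.add_one_mem (u := x) (w := [])
      (by simpa using hv) hy
    obtain ⟨y₁, y₂, rfl, hy₂⟩ := List.exists_split_last h1
    simp only [List.mem_append, List.mem_cons, not_or] at hy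
    have h2 := act_eq_act_add_one hn (u := x ++ (s : ZMod n) :: y₁) (v := y₂) (s := s + 1)
      (by simpa using hy₂) (by simpa using hy.2.2)
    simp only [Int.cast_add, Int.cast_one, List.append_assoc, List.cons_append] at h2
    have h3 := act_le_of_mem hs
    rw [show s + 1 + 1 = s + 2 by ring] at h2
    rw [if_pos (h2 ▸ h3), h2]
  · rw [act_eq_self hs, if_neg]
    have := lt_act_of_not_mem (p := s + 2) hs (by omega)
    omega

/-- Induction on the last letter `a` of `v`: commute an `a` to the end of `w` and cancel it. Off the
class of `a + 1` cancelling is immediate, and on that class `IsAlternating.act_add_one_eq` recovers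
the values from those at the next integer. -/
theorem IsAlternating.toMonoid_eq (hn : 3 ≤ n) : ∀ {v w : CWord n}, IsAlternating v →
    IsAlternating w → (∀ p, act v p = act w p) → v.toMonoid = w.toMonoid := by
  intro v
  induction v using List.reverseRecOn with
  | nil =>
    intro w _ _ h
    have : w = [] := by
      rw [List.eq_nil_iff_forall_not_mem]
      intro a ha
      obtain ⟨s, rfl⟩ := ZMod.intCast_surjective a
      have := act_le_of_mem ha
      rw [← h, act_nil] at this
      omega
    rw [this]
  | append_singleton v a ih =>
    intro w hv hw h
    obtain ⟨u₁, u₂, rfl, h0, h1, h2⟩ := hv.exists_split_of_act_eq hn hw h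
    have hcomm : CWord.toMonoid (u₁ ++ a :: u₂) = CWord.toMonoid (u₁ ++ u₂ ++ [a]) := by
      rw [toMonoid_append, toMonoid_cons, gen_mul_toMonoid_comm h1 h2, toMonoid_append,
        toMonoid_append, mul_assoc]
      rfl
    have halt : IsAlternating (u₁ ++ u₂ ++ [a]) := by
      intro b
      have := hw b
      by_cases hb : a = b ∨ a = b + 1
      · have e : pairFilter b u₂ = [] := by
          rcases hb with rfl | rfl
          · exact pairFilter_eq_nil h0 h2
          · exact pairFilter_eq_nil (by simpa using h1) h0
        rw [pairFilter_append, pairFilter_cons_of_mem hb, e] at this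
        rw [pairFilter_append, pairFilter_append, e, pairFilter_cons_of_mem hb]
        simpa [pairFilter] using this
      · rw [pairFilter_append, pairFilter_cons_of_not_mem hb] at this
        rw [pairFilter_append, pairFilter_append, pairFilter_cons_of_not_mem hb]
        simpa [pairFilter] using this
    have hact : ∀ p, act (v ++ [a]) p = act (u₁ ++ u₂ ++ [a]) p := fun p => by
      rw [h, act_eq_of_toMonoid_eq hn hcomm]
    rw [hcomm, toMonoid_append_singleton, toMonoid_append_singleton, ih hv.left halt.left]
    have key : ∀ p : ℤ, (p : ZMod n) ≠ a + 1 → act v p = act (u₁ ++ u₂) p := by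
      intro p hp
      have := hact p
      rwa [act_append v, act_append (u₁ ++ u₂), act_cons, act_nil, genAct_of_ne hp] at this
    intro p
    by_cases hp : (p : ZMod n) = a + 1
    · obtain ⟨s, rfl⟩ : ∃ s, p = s + 1 := ⟨p - 1, by ring⟩
      obtain rfl : (s : ZMod n) = a := by push_cast at hp; simpa using hp
      rw [hv.act_add_one_eq hn, halt.act_add_one_eq hn, key]
      have := ZMod.one_ne_zero_of_three_le hn
      push_cast
      intro h
      exact this (by linear_combination h)
    · exact key p hp

/-- The action of `C_n` on the integers is faithful. -/
theorem toMonoid_eq_of_act_eq (hn : 3 ≤ n) {v w : CWord n} (h : ∀ p, act v p = act w p) :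
    v.toMonoid = w.toMonoid := by
  obtain ⟨v', hv', ev⟩ := exists_reducedWord hn v.toMonoid
  obtain ⟨w', hw', ew⟩ := exists_reducedWord hn w.toMonoid
  rw [← ev, ← ew]
  refine hv'.isAlternating.toMonoid_eq hn hw'.isAlternating fun p => ?_
  rw [act_eq_of_toMonoid_eq hn ev, act_eq_of_toMonoid_eq hn ew, h]

end Faithful

/-! ### The action of `x_n q_i` -/

section Core
variable {n : ℕ}

/-- The residues of `i + 2, …, n`, which form the image of `x_n q_i`. -/
def core (n i : ℕ) : Set (ZMod n) := {c | ∃ t, i + 2 ≤ t ∧ t ≤ n ∧ c = letter n t}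

theorem ncard_core {i : ℕ} (hi : i + 2 ≤ n) : (core n i).ncard = n - 1 - i := by
  have e : core n i = ((Finset.Icc (i + 2) n).image (letter n) : Finset (ZMod n)) := by
    ext c
    simp [core, and_assoc, eq_comm]
  rw [e, Set.ncard_coe_finset, Finset.card_image_of_injOn, Nat.card_Icc]
  · omega
  · intro a ha b hb h
    simp only [Finset.coe_Icc, Set.mem_Icc] at ha hb
    exact letter_inj (by omega) ha.2 (by omega) hb.2 h

theorem intCast_eq_intCast_of_lt {p q : ℤ} (h : (p : ZMod n) = q) (h1 : p < q + n)
    (h2 : q < p + n) : p = q := by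
  rw [ZMod.intCast_eq_intCast_iff_dvd_sub] at h
  have := Int.eq_zero_of_abs_lt_dvd h (by rw [abs_lt]; constructor <;> omega)
  omega

theorem intCast_eq_intCast_iff_exists {p q : ℤ} :
    (p : ZMod n) = q ↔ ∃ t : ℤ, q = p + n * t := by
  rw [ZMod.intCast_eq_intCast_iff_dvd_sub]
  constructor
  · rintro ⟨t, h⟩; exact ⟨t, by omega⟩
  · rintro ⟨t, h⟩; exact ⟨t, by omega⟩

theorem exists_eq_add_mul (hn : 3 ≤ n) (p : ℤ) :
    ∃ r t : ℤ, 1 ≤ r ∧ r ≤ n ∧ p = r + n * t := by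
  refine ⟨(p - 1) % n + 1, (p - 1) / n, ?_, ?_, ?_⟩
  · have := Int.emod_nonneg (p - 1) (show (n : ℤ) ≠ 0 by omega); omega
  · have := Int.emod_lt_of_pos (p - 1) (show (0 : ℤ) < n by omega); omega
  · have := Int.emod_add_mul_ediv (p - 1) n; omega

theorem mem_core_iff {i : ℕ} {p : ℤ} (h1 : 1 ≤ p) (h2 : p ≤ n) :
    (p : ZMod n) ∈ core n i ↔ (i : ℤ) + 2 ≤ p := by
  constructor
  · rintro ⟨t, h, h', e⟩
    have := intCast_eq_intCast_of_lt (n := n) (p := p) (q := t) (by simpa [letter] using e)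
      (by omega) (by omega)
    omega
  · intro h
    exact ⟨p.toNat, by omega, by omega, by
      rw [letter, ← Int.cast_natCast, Int.toNat_of_nonneg (by omega)]⟩

theorem zero_mem_core {i : ℕ} (hi : i + 2 ≤ n) : ((0 : ℤ) : ZMod n) ∈ core n i :=
  ⟨n, hi, le_rfl, by simp [letter]⟩

theorem genAct_letter {t : ℕ} {p : ℤ} (h1 : p < t + 1 + n) (h2 : t + 1 < p + n) :
    genAct (letter n t) p = if p = t + 1 then p - 1 else p := by
  unfold genAct
  congr 1
  refine propext ⟨fun h => ?_, fun h => ?_⟩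
  · exact intCast_eq_intCast_of_lt (n := n) (q := t + 1) (by simpa [letter] using h)
      (by omega) (by omega)
  · simp [letter, h]

/-- As the rightmost letter acts first, an ascending word sweeps a point all the way down, whereas a
descending word moves each point at most one step. -/
theorem act_upWord {j : ℕ} (hj : j + 1 ≤ n) {p : ℤ} (h1 : 1 ≤ p) (h2 : p ≤ n) :
    act (upWord n 1 j) p = if p ≤ j + 1 then 1 else p := by
  induction j generalizing p with
  | zero =>
    rw [upWord_of_lt (by omega), act_nil]
    split_ifs <;> omega
  | succ j ih =>
    rw [upWord_succ_right (by omega), act_append, act_cons, act_nil,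
      genAct_letter (by push_cast; omega) (by push_cast; omega)]
    split_ifs with h3 h4 h4
    all_goals rw [ih (by omega) (by omega) (by omega)]
    all_goals split_ifs <;> omega

theorem act_downWord {a b : ℕ} (ha : 1 ≤ a) (hb : b + 1 ≤ n) {p : ℤ} (h1 : 1 ≤ p) (h2 : p ≤ n) :
    act (downWord n b a) p = if a + 1 ≤ p ∧ p ≤ b + 1 then p - 1 else p := by
  induction b with
  | zero =>
    rw [downWord_of_lt (by omega), act_nil]
    split_ifs <;> omega
  | succ b ih =>
    by_cases hab : a ≤ b + 1
    · rw [downWord_succ_left hab, act_cons, ih (by omega)]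
      split_ifs with h3 h4 h4
      all_goals rw [genAct_letter (by push_cast; omega) (by push_cast; omega)]
      all_goals split_ifs <;> omega
    · rw [downWord_of_lt (by omega), act_nil]
      split_ifs <;> omega

/-- The descending branch lowers `i + 2, …, n` by one, the ascending branch collapses `1, …, i + 1`
to `1`, and `x_n` sends `1` to `0`. -/
theorem act_xqWord {i : ℕ} (hi : i + 2 ≤ n) {p : ℤ} (h1 : 1 ≤ p) (h2 : p ≤ n) :
    act (xqWord n i) p = if p ≤ i + 2 then 0 else p - 1 := by
  rw [xqWord, act_cons, act_append, act_downWord (by omega) (by omega) h1 h2, ← letter_zero]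
  split_ifs
  all_goals rw [act_upWord (by omega) (by omega) (by omega)]
  all_goals split_ifs
  all_goals rw [genAct_letter (by push_cast; omega) (by push_cast; omega)]
  all_goals split_ifs <;> omega

theorem intCast_add_mul (p t : ℤ) : ((p + n * t : ℤ) : ZMod n) = p := by simp

theorem act_xqWord_mem_core (hn : 3 ≤ n) {i : ℕ} (hi : i + 2 ≤ n) (p : ℤ) :
    (act (xqWord n i) p : ZMod n) ∈ core n i := by
  obtain ⟨r, t, h1, h2, rfl⟩ := exists_eq_add_mul hn p
  rw [act_add_mul, intCast_add_mul, act_xqWord hi h1 h2]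
  split_ifs with h
  · exact zero_mem_core hi
  · rw [mem_core_iff (by omega) (by omega)]; omega

theorem act_xqWord_lt (hn : 3 ≤ n) {i : ℕ} (hi : i + 2 ≤ n) (p : ℤ) :
    act (xqWord n i) p < p := by
  obtain ⟨r, t, h1, h2, rfl⟩ := exists_eq_add_mul hn p
  rw [act_add_mul, act_xqWord hi h1 h2]
  split_ifs with h <;> omega

/-- `x_n q_i` sends an integer to the largest smaller integer in the core. -/
theorem le_act_xqWord (hn : 3 ≤ n) {i : ℕ} (hi : i + 2 ≤ n) {p y : ℤ}
    (hy : (y : ZMod n) ∈ core n i) (h : y < p) : y ≤ act (xqWord n i) p := by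
  obtain ⟨r, t, h1, h2, rfl⟩ := exists_eq_add_mul hn p
  rw [act_add_mul, act_xqWord hi h1 h2]
  obtain ⟨x, rfl⟩ : ∃ x, y = x + n * t := ⟨y - n * t, by ring⟩
  rw [intCast_add_mul] at hy
  split_ifs with h3
  · by_contra! h4
    rw [mem_core_iff (by omega) (by omega)] at hy
    omega
  · omega

/-- The preimage is the successor in the core: `r + 1`, or `i + 2` in the next period when `r = n`.
-/
theorem exists_act_xqWord_eq (hn : 3 ≤ n) {i : ℕ} (hi : i + 2 ≤ n) {y : ℤ}
    (hy : (y : ZMod n) ∈ core n i) :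
    ∃ p : ℤ, (p : ZMod n) ∈ core n i ∧ act (xqWord n i) p = y := by
  obtain ⟨r, t, h1, h2, rfl⟩ := exists_eq_add_mul hn y
  rw [intCast_add_mul, mem_core_iff h1 h2] at hy
  rcases h2.lt_or_eq with h2 | rfl
  · refine ⟨r + 1 + n * t, ?_, ?_⟩
    · rw [intCast_add_mul, mem_core_iff (by omega) (by omega)]; omega
    · rw [act_add_mul, act_xqWord hi (by omega) (by omega), if_neg (by omega)]; ring
  · refine ⟨i + 2 + n * (1 + t), ?_, ?_⟩
    · rw [intCast_add_mul, mem_core_iff (by omega) (by omega)]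
    · rw [act_add_mul, act_xqWord hi (by omega) (by omega), if_pos (by omega)]; ring

/-! ### Residues of the image -/

/-- The residues of the values of a word. -/
def residues (w : CWord n) : Set (ZMod n) := Set.range fun p : ℤ => (act w p : ZMod n)

/-- The map on residues induced by a word. -/
def resAct (w : CWord n) (c : ZMod n) : ZMod n := (act w (c.cast : ℤ) : ZMod n)

/-- The choice of lift is immaterial because the action commutes with translation by `n`. -/
theorem resAct_intCast (w : CWord n) (p : ℤ) : resAct w (p : ZMod n) = (act w p : ZMod n) := by
  have h : (((p : ZMod n).cast : ℤ) : ZMod n) = (p : ZMod n) := by simp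
  obtain ⟨t, ht⟩ := intCast_eq_intCast_iff_exists.1 h
  rw [resAct]
  conv_rhs => rw [ht, act_add_mul, intCast_add_mul]

theorem residues_append (u v : CWord n) : residues (u ++ v) = resAct u '' residues v := by
  rw [residues, residues, ← Set.range_comp]
  congr 1
  funext p
  simp [resAct_intCast]

theorem residues_append_subset (u v : CWord n) : residues (u ++ v) ⊆ residues u := by
  rintro _ ⟨p, rfl⟩
  exact ⟨act v p, by simp⟩

theorem ncard_residues_append_le (hn : 3 ≤ n) (u v : CWord n) :
    (residues (u ++ v)).ncard ≤ (residues v).ncard := by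
  have : NeZero n := ⟨by omega⟩
  rw [residues_append]
  exact Set.ncard_image_le (Set.toFinite _)

theorem residues_xqWord_append_subset (hn : 3 ≤ n) {i : ℕ} (hi : i + 2 ≤ n) (v : CWord n) :
    residues (xqWord n i ++ v) ⊆ core n i := by
  rintro _ ⟨p, rfl⟩
  simpa using act_xqWord_mem_core hn hi (act v p)

/-- The power `w ^ k` of a word. -/
def wordPow (w : CWord n) (k : ℕ) : CWord n := (List.replicate k w).flatten

theorem wordPow_succ (w : CWord n) (k : ℕ) : wordPow w (k + 1) = w ++ wordPow w k := by
  simp [wordPow, List.replicate_succ]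

theorem toMonoid_wordPow (w : CWord n) (k : ℕ) : (wordPow w k).toMonoid = w.toMonoid ^ k := by
  induction k with
  | zero => simp [wordPow, toMonoid_nil]
  | succ k ih => rw [wordPow_succ, toMonoid_append, ih, pow_succ']

theorem core_subset_residues_wordPow (hn : 3 ≤ n) {i : ℕ} (hi : i + 2 ≤ n) (k : ℕ) :
    core n i ⊆ residues (wordPow (xqWord n i) k) := by
  suffices ∀ y : ℤ, (y : ZMod n) ∈ core n i → ∃ p, act (wordPow (xqWord n i) k) p = y by
    intro c hc
    obtain ⟨y, rfl⟩ := ZMod.intCast_surjective c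
    obtain ⟨p, hp⟩ := this y hc
    exact ⟨p, by simp [hp]⟩
  induction k with
  | zero => intro y _; exact ⟨y, by simp [wordPow]⟩
  | succ k ih =>
    intro y hy
    obtain ⟨p, hp, rfl⟩ := exists_act_xqWord_eq hn hi hy
    obtain ⟨q, rfl⟩ := ih p hp
    exact ⟨q, by rw [wordPow_succ, act_append]⟩

/-- Some `a w b` is a power of `x_n q_i`, whose image contains the core, and multiplication on
either side cannot raise the rank. -/
theorem le_ncard_residues (hn : 3 ≤ n) {i : ℕ} (hi : i + 2 ≤ n) {w : CWord n}
    (hw : w.toMonoid ∉ idealI n i) : n - 1 - i ≤ (residues w).ncard := by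
  have : NeZero n := ⟨by omega⟩
  rw [idealI, Set.mem_ofPred_eq, ← Set.not_nonempty_iff_eq_empty, not_not] at hw
  obtain ⟨z, ⟨a, b, rfl⟩, hz⟩ := hw
  rw [SetLike.mem_coe, Submonoid.mem_closure_singleton] at hz
  obtain ⟨k, hk⟩ := hz
  obtain ⟨a, rfl⟩ := toMonoid_surjective a
  obtain ⟨b, rfl⟩ := toMonoid_surjective b
  have e : CWord.toMonoid (a ++ (w ++ b)) = (wordPow (xqWord n i) k).toMonoid := by
    rw [toMonoid_wordPow, toMonoid_append, toMonoid_append, ← mul_assoc, ← hk, xq]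
  have h1 : residues (a ++ (w ++ b)) = residues (wordPow (xqWord n i) k) := by
    simp only [residues, act_eq_of_toMonoid_eq hn e]
  calc n - 1 - i = (core n i).ncard := (ncard_core hi).symm
    _ ≤ (residues (a ++ (w ++ b))).ncard := by
      rw [h1]
      exact Set.ncard_le_ncard (core_subset_residues_wordPow hn hi k) (Set.toFinite _)
    _ ≤ (residues (w ++ b)).ncard := ncard_residues_append_le hn _ _
    _ ≤ _ := Set.ncard_le_ncard (residues_append_subset _ _) (Set.toFinite _)

/-- Equal values would make the residues equal, hence `y' = y + n t`, and equivariance then forces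
`n t = 0`. -/
theorem lt_of_injOn_residues {a : CWord n} {s : Set (ZMod n)} (h : Set.InjOn (resAct a) s)
    {y y' : ℤ} (hy : (y : ZMod n) ∈ s) (hy' : (y' : ZMod n) ∈ s) (hlt : y < y') :
    act a y < act a y' := by
  refine lt_of_le_of_ne (act_mono a hlt.le) fun e => ?_
  have h1 : (y : ZMod n) = y' := h hy hy' (by rw [resAct_intCast, resAct_intCast, e])
  obtain ⟨t, rfl⟩ := intCast_eq_intCast_iff_exists.1 h1
  rw [act_add_mul] at e
  omega

/-- If `a (x_n q_i) b` is not in the ideal, then `(x_n q_i) b` is onto the core and `a` is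
injective on it. -/
theorem bijOn_of_not_mem_idealI (hn : 3 ≤ n) {i : ℕ} (hi : i + 2 ≤ n) {a b : CWord n}
    (h : CWord.toMonoid (a ++ (xqWord n i ++ b)) ∉ idealI n i) :
    (∀ y : ℤ, (y : ZMod n) ∈ core n i → ∃ p, act (xqWord n i ++ b) p = y) ∧
      Set.InjOn (resAct a) (core n i) := by
  have : NeZero n := ⟨by omega⟩
  have h1 := le_ncard_residues hn hi h
  have h2 := ncard_residues_append_le hn a (xqWord n i ++ b)
  have h3 := residues_xqWord_append_subset hn hi b
  have h4 : residues (xqWord n i ++ b) = core n i :=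
    Set.eq_of_subset_of_ncard_le h3 (by rw [ncard_core hi]; omega) (Set.toFinite _)
  constructor
  · intro y hy
    rw [← h4] at hy
    obtain ⟨p, hp⟩ := hy
    obtain ⟨t, ht⟩ := intCast_eq_intCast_iff_exists.1 hp
    exact ⟨p + n * t, by rw [act_add_mul, ht]⟩
  · refine Set.injOn_of_ncard_image_eq ?_ (Set.toFinite _)
    rw [residues_append, h4] at h1
    refine le_antisymm (Set.ncard_image_le (Set.toFinite _)) ?_
    rwa [ncard_core hi]

end Core

/-! ### The sandwich property -/

section Sandwich
variable {n : ℕ}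

theorem act_wordPow_succ_right (w : CWord n) (k : ℕ) (p : ℤ) :
    act (wordPow w k) (act w p) = act (wordPow w (k + 1)) p := by
  induction k with
  | zero => simp [wordPow]
  | succ k ih => rw [wordPow_succ, act_append, ih, wordPow_succ w (k + 1), act_append]

/-- Every smaller element of the core is reached by a power of `x_n q_i`. -/
theorem exists_wordPow_act_eq (hn : 3 ≤ n) {i : ℕ} (hi : i + 2 ≤ n) (d : ℕ) :
    ∀ {y z : ℤ}, (z : ZMod n) ∈ core n i → y - z = d →
      (y : ZMod n) ∈ core n i → ∃ k, act (wordPow (xqWord n i) k) y = z := by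
  induction d using Nat.strong_induction_on with
  | _ d ih =>
    intro y z hz hd hy
    rcases Nat.eq_zero_or_pos d with rfl | hpos
    · exact ⟨0, by simp [wordPow]; omega⟩
    · have h1 := le_act_xqWord hn hi hz (show z < y by omega)
      have h2 := act_xqWord_lt hn hi y
      obtain ⟨k, hk⟩ := ih (act (xqWord n i) y - z).toNat (by omega) hz (by omega)
        (act_xqWord_mem_core hn hi y)
      exact ⟨k + 1, by rw [← act_wordPow_succ_right, hk]⟩

theorem sandwich (hn : 3 ≤ n) {i : ℕ} (hi : i + 2 ≤ n) (w : CycleMonoid n)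
    (h : xq n i * w * xq n i ∉ idealI n i) : ∃ k, 2 ≤ k ∧ xq n i * w * xq n i = xq n i ^ k := by
  obtain ⟨w, rfl⟩ := toMonoid_surjective w
  set f := xqWord n i with hf
  have e : xq n i * w.toMonoid * xq n i = CWord.toMonoid (f ++ w ++ f) := by
    rw [toMonoid_append, toMonoid_append, xq]
  rw [e] at h ⊢
  have hinj := (bijOn_of_not_mem_idealI hn hi (a := f ++ w) (b := []) (by simpa using h)).2
  have hsurj := (bijOn_of_not_mem_idealI hn hi (a := []) (b := w ++ f) (by simpa using h)).1
  have hlt := fun {y y' : ℤ} => lt_of_injOn_residues hinj (y := y) (y' := y')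
  have hmem : ∀ p : ℤ, (act (f ++ w) p : ZMod n) ∈ core n i := fun p => by
    rw [act_append]; exact act_xqWord_mem_core hn hi _
  have hcomm : ∀ y : ℤ, (y : ZMod n) ∈ core n i →
      act (f ++ w) (act f y) = act f (act (f ++ w) y) := by
    intro y hy
    have h1 := act_xqWord_lt hn hi y
    have h2 := hlt (act_xqWord_mem_core hn hi y) hy h1
    -- One inequality holds because `x_n q_i` gives the largest smaller core element. For the other,
    -- surjectivity writes the right side as the image of a core point `act f p`, which must lie
    -- below `y`.
    refine le_antisymm (le_act_xqWord hn hi (hmem _) h2) ?_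
    obtain ⟨p, hp⟩ := hsurj (act f (act (f ++ w) y)) (act_xqWord_mem_core hn hi _)
    rw [← List.append_assoc, act_append] at hp
    rw [← hp]
    refine act_mono _ (le_act_xqWord hn hi (act_xqWord_mem_core hn hi p) ?_)
    refine lt_of_act_lt (f ++ w) ?_
    rw [hp]
    exact act_xqWord_lt hn hi _
  obtain ⟨k, hk⟩ := exists_wordPow_act_eq hn hi (0 - act (f ++ w) 0).toNat (y := 0) (hmem 0)
    (by have := act_le (f ++ w) 0; omega) (zero_mem_core hi)
  have hk1 : 1 ≤ k := by
    rcases Nat.eq_zero_or_pos k with rfl | h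
    · have h1 : act (f ++ w) (0 : ℤ) < 0 := by
        rw [act_append]
        exact (act_xqWord_lt hn hi _).trans_le (act_le w 0)
      rw [show wordPow (xqWord n i) 0 = [] from rfl, act_nil] at hk
      omega
    · exact h
  have hpow : ∀ m, act (f ++ w) (act (wordPow f m) 0) = act (wordPow f k) (act (wordPow f m) 0) := by
    intro m
    induction m with
    | zero => simpa [wordPow] using hk.symm
    | succ m ih =>
      have hm : ((act (wordPow f m) (0 : ℤ) : ℤ) : ZMod n) ∈ core n i := by
        cases m with
        | zero => simpa [wordPow] using zero_mem_core hi
        | succ m => rw [wordPow_succ, act_append]; exact act_xqWord_mem_core hn hi _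
      rw [wordPow_succ, act_append f (wordPow f m), hcomm _ hm, ih, act_wordPow_succ_right,
        wordPow_succ, act_append f (wordPow f k)]
  have hall : ∀ y : ℤ, (y : ZMod n) ∈ core n i → act (f ++ w) y = act (wordPow f k) y := by
    intro y hy
    obtain ⟨r, t, h1, h2, rfl⟩ := exists_eq_add_mul hn y
    -- The translate `r - n` is at most `0`, so a power of `x_n q_i` reaches it from `0`;
    -- periodicity carries the equality back to `y`.
    obtain ⟨m, hm⟩ := exists_wordPow_act_eq hn hi (n - r).toNat (y := 0) (z := r + n * (-1))
      (by rwa [intCast_add_mul] at hy ⊢) (by omega) (zero_mem_core hi)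
    have h3 : r + n * t = act (wordPow f m) 0 + n * (1 + t) := by rw [hm]; ring
    rw [h3, act_add_mul, act_add_mul, hpow]
  refine ⟨k + 1, by omega, ?_⟩
  rw [xq, ← toMonoid_wordPow]
  refine toMonoid_eq_of_act_eq hn fun p => ?_
  rw [act_append, hall _ (act_xqWord_mem_core hn hi p), act_wordPow_succ_right]

end Sandwich

/-! ### Letters to the right of an occurrence of `x_n` -/

section Crossing
variable {n : ℕ}

/-- A point passing from above `s` to `s` or below is moved by an occurrence of the letter `s`. -/
theorem exists_crossing {w : CWord n} {s p : ℤ} (hp : s < p) (h : act w p ≤ s) :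
    ∃ u v, w = u ++ (s : ZMod n) :: v ∧ act v p = s + 1 := by
  induction w with
  | nil => rw [act_nil] at h; omega
  | cons c w ih =>
    by_cases h' : act w p ≤ s
    · obtain ⟨u, v, rfl, hv⟩ := ih h'
      exact ⟨c :: u, v, rfl, hv⟩
    · rw [act_cons] at h
      have h1 := sub_one_le_genAct c (act w p)
      have h2 : act w p = s + 1 := by omega
      refine ⟨[], w, ?_, h2⟩
      by_contra hc
      rw [genAct_of_ne] at h
      · exact h' h
      · rw [h2]
        push_cast
        intro e
        exact hc (by rw [add_right_cancel e]; rfl)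

/-- A word representing an element of `C_n (x_n q_i) C_n` outside the ideal has an occurrence of
`x_n` to the right of which all the other letters occur. -/
theorem exists_split_letter_mem (hn : 3 ≤ n) {i : ℕ} (hi : i + 2 ≤ n) {w a b : CWord n}
    (hw : w.toMonoid = CWord.toMonoid (a ++ (xqWord n i ++ b))) (h : w.toMonoid ∉ idealI n i) :
    ∃ u v, w = u ++ letter n n :: v ∧ ∀ t, 1 ≤ t → t < n → letter n t ∈ v := by
  have hact := act_eq_of_toMonoid_eq hn hw
  obtain ⟨hsurj, hinj⟩ := bijOn_of_not_mem_idealI hn hi (hw ▸ h)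
  have hlt := fun {y y' : ℤ} => lt_of_injOn_residues hinj (y := y) (y' := y')
  set g := xqWord n i ++ b with hg
  have hgn : (((n : ℤ)) : ZMod n) = letter n n := by simp [letter]
  have hgt : ∀ p, act g p < p := fun p => by
    rw [hg, act_append]
    exact (act_xqWord_lt hn hi _).trans_le (act_le b p)
  -- A preimage of `0` below `i + 2` may be raised to `i + 2`, since `x_n q_i` already sends `i + 2`
  -- to `0`.
  obtain ⟨p₀, hp₀, hi₀⟩ : ∃ p₀, act g p₀ = 0 ∧ (i : ℤ) + 2 ≤ p₀ := by
    obtain ⟨p, hp⟩ := hsurj 0 (zero_mem_core hi)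
    refine ⟨max p (i + 2), ?_, le_max_right _ _⟩
    have h1 : act g (i + 2) ≤ 0 := by
      rw [hg, act_append]
      refine (act_mono _ (act_le b _)).trans ?_
      rw [act_xqWord hi (by omega) (by omega), if_pos le_rfl]
    rcases le_total p (i + 2) with h2 | h2
    · rw [max_eq_right h2]
      have := act_mono g h2
      omega
    · rw [max_eq_left h2, hp]
  have hpn : act g (p₀ + n) = n := by
    have := act_add_mul g p₀ 1
    rw [mul_one, hp₀] at this
    omega
  -- The trajectory of `p₀ + n` ends at or below `n`, so some `x_n` moves it from `n + 1`. This is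
  -- the required occurrence.
  obtain ⟨u, v, rfl, hv⟩ := exists_crossing (w := w) (s := n) (p := p₀ + n) (by omega) (by
    rw [hact, act_append, hpn]; exact act_le a _)
  have hv₀ : act v p₀ = 1 := by
    have := act_add_mul v p₀ 1
    rw [mul_one, hv] at this
    omega
  rw [hgn] at hw h hact ⊢
  refine ⟨u, v, rfl, fun t ht ht' => ?_⟩
  have hcast : ((t : ℤ) : ZMod n) = letter n t := by simp [letter]
  by_cases hti : t ≤ i + 1
  · rw [← hcast]
    exact mem_of_act_le (p := p₀) (by omega) (by omega)
  -- Since `a` is strictly increasing on the core, points with distinct `g`-values are still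
  -- distinct just before `u` acts. Starting from `p₀ + n`, each step down the core therefore forces
  -- the next point at least one lower.
  · have key : ∀ d : ℕ, (i : ℤ) + 2 ≤ n - d →
        ∃ p, act g p = n - d ∧ act (letter n n :: v) p ≤ n - d := by
      intro d
      induction d with
      | zero =>
        intro _
        refine ⟨p₀ + n, by simpa using hpn, ?_⟩
        rw [act_cons, hv, ← hgn, genAct_self]; simp
      | succ d ih =>
        intro hd
        push_cast at hd ⊢
        obtain ⟨p, hp, hp'⟩ := ih (by omega)
        obtain ⟨q, hq⟩ := hsurj (n - (d + 1)) ((mem_core_iff (by omega) (by omega)).2 (by omega))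
        refine ⟨q, hq, ?_⟩
        have h1 : act a (act g q) < act a (act g p) := by
          rw [hq, hp]
          exact hlt ((mem_core_iff (by omega) (by omega)).2 (by omega))
            ((mem_core_iff (by omega) (by omega)).2 (by omega)) (by omega)
        rw [← act_append, ← act_append, ← hact, ← hact, act_append, act_append] at h1
        have := lt_of_act_lt u h1
        omega
    obtain ⟨p, hp, hp'⟩ := key (n - t) (by omega)
    have e : (n : ℤ) - (n - t : ℕ) = t := by omega
    rw [e] at hp hp'
    -- The point `p` starts above `t` and ends at or below it, so the letter `t` must occur.
    have h1 := hgt p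
    have h2 := mem_of_act_le (w := letter n n :: v) (s := t) (by omega) hp'
    rw [hcast, List.mem_cons] at h2
    exact h2.resolve_left (letter_ne_of_lt ht' (by omega))

end Crossing

/-! ### The shape of reduced words -/

section Blocks
variable {n : ℕ}

theorem letter_not_mem_upWord {a b t : ℕ} (h : t < a ∨ b < t) (h1 : t < a + n) (h2 : b < t + n) :
    letter n t ∉ upWord n a b := by
  rw [mem_upWord]
  rintro ⟨s, hs, hs', e⟩
  rcases h with h | h
  · exact letter_ne_of_lt (by omega) (by omega) e
  · exact letter_ne_of_lt (by omega) (by omega) e.symm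

theorem letter_not_mem_downWord {a b t : ℕ} (h : t < a ∨ b < t) (h1 : t < a + n)
    (h2 : b < t + n) : letter n t ∉ downWord n b a := by
  rw [downWord, List.mem_reverse]
  exact letter_not_mem_upWord h h1 h2

theorem IsReducedWord.mem_between_letter {w : CWord n} (h : IsReducedWord w) {t : ℕ} (ht : 1 ≤ t)
    {u : CWord n} (x y : CWord n) (hw : w = x ++ letter n t :: (u ++ letter n t :: y))
    (ha : letter n t ∉ u) : letter n (t - 1) ∈ u ∧ letter n (t + 1) ∈ u := by
  rw [← letter_sub_one ht, ← letter_add_one]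
  exact h.mem_between ⟨x, y, by simp [hw]⟩ ha

/-- After `x_n x_1 ⋯ x_j` a repeated letter `t` lacks `t - 1` in between, and a letter strictly
between `j + 1` and `n - 1` is excluded by (2) or (3). Only `j + 1`, which extends the branch, and
`n - 1` remain; `d` counts the possible extensions. -/
theorem IsReducedWord.exists_upWord (hn : 3 ≤ n) {T : CWord n}
    (h : IsReducedWord (letter n n :: T)) (d : ℕ) : ∀ {j : ℕ} {R : CWord n}, j + d + 2 = n →
    T = upWord n 1 j ++ R → ∃ j R, j + 2 ≤ n ∧ T = upWord n 1 j ++ R ∧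
      (R = [] ∨ ∃ R', R = letter n (n - 1) :: R') := by
  induction d with
  | zero =>
    intro j R hj hT
    refine ⟨j, R, by omega, hT, ?_⟩
    rcases R with _ | ⟨c, R⟩
    · exact .inl rfl
    right
    obtain ⟨t, ht, ht', rfl⟩ := exists_letter hn c
    suffices t = n - 1 from ⟨R, by rw [this]⟩
    by_contra hne
    rcases ht'.lt_or_eq with h1 | rfl
    · have hs := upWord_split (n := n) (a := 1) (k := t) (b := j) ht (by omega) le_rfl
      exact letter_not_mem_upWord (n := n) (by omega) (by omega) (by omega)
        (h.mem_between_letter ht (u := upWord n (t + 1) j) (letter n n :: upWord n 1 (t - 1)) R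
          (by rw [hT, hs]; simp) (letter_not_mem_upWord (by omega) (by omega) (by omega))).1
    · exact letter_not_mem_upWord (n := t) (by omega) (by omega) (by omega)
        (h.mem_between_letter ht (u := upWord t 1 j) [] R
          (by rw [hT]; simp) (letter_not_mem_upWord (by omega) (by omega) (by omega))).1
  | succ d ih =>
    intro j R hj hT
    rcases R with _ | ⟨c, R⟩
    · exact ⟨j, [], by omega, hT, .inl rfl⟩
    obtain ⟨t, ht, ht', rfl⟩ := exists_letter hn c
    rcases ht'.lt_or_eq with h1 | rfl
    · by_cases h2 : t = n - 1
      · exact ⟨j, _, by omega, hT, .inr ⟨R, by rw [h2]⟩⟩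
      · rcases lt_trichotomy t (j + 1) with h3 | rfl | h3
        · have hs := upWord_split (n := n) (a := 1) (k := t) (b := j) ht (by omega) le_rfl
          exact absurd (h.mem_between_letter ht (u := upWord n (t + 1) j)
            (letter n n :: upWord n 1 (t - 1)) R (by rw [hT, hs]; simp)
            (letter_not_mem_upWord (by omega) (by omega) (by omega))).1
            (letter_not_mem_upWord (n := n) (by omega) (by omega) (by omega))
        · exact ih (j := j + 1) (R := R) (by omega) (by
            rw [hT, upWord_succ_right (by omega)]; simp)
        · exfalso
          rcases Nat.eq_zero_or_pos j with rfl | hj0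
          · refine h _ _ (Reduction.two t n ht (by omega) (by omega) le_rfl) ⟨[], R, ?_⟩
            rw [hT, upWord_of_lt (by omega)]; simp
          · refine h _ _ (Reduction.three j t hj0 h3 (by omega)) ⟨[], R, ?_⟩
            rw [hT]; simp
    · exact absurd (h.mem_between_letter ht (u := upWord t 1 j) [] R
        (by rw [hT]; simp) (letter_not_mem_upWord (by omega) (by omega) (by omega))).1
        (letter_not_mem_upWord (n := t) (by omega) (by omega) (by omega))

/-- After `x_k` a letter below `k - 1` is excluded by (2), and one in `k, …, n - 1` lacks its
successor in between. What remains is `k - 1`, extending the branch, or `x_n`, which needs `j ≥ 1`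
because an `x_1` must separate two copies of `x_n`. -/
theorem IsReducedWord.exists_downWord (hn : 3 ≤ n) {T : CWord n}
    (h : IsReducedWord (letter n n :: T)) {j : ℕ} (d : ℕ) : ∀ {k : ℕ} {R : CWord n},
    k = j + 1 + d → k < n → T = upWord n 1 j ++ (downWord n (n - 1) k ++ R) →
    ∃ k R, j < k ∧ k < n ∧ T = upWord n 1 j ++ (downWord n (n - 1) k ++ R) ∧
      (k = j + 1 ∨ R = [] ∨ 1 ≤ j ∧ ∃ R', R = letter n n :: R') := by
  induction d with
  | zero => intro k R hk hkn hT; exact ⟨k, R, by omega, hkn, hT, .inl hk⟩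
  | succ d ih =>
    intro k R hk hkn hT
    rcases R with _ | ⟨c, R⟩
    · exact ⟨k, [], by omega, hkn, hT, .inr (.inl rfl)⟩
    obtain ⟨t, ht, ht', rfl⟩ := exists_letter hn c
    rcases ht'.lt_or_eq with h1 | h1
    · rcases lt_trichotomy t (k - 1) with h3 | h3 | h3
      · refine absurd ?_
          (h _ _ (Reduction.two t k ht (by omega) (by omega) (by omega)))
        refine ⟨letter n n :: (upWord n 1 j ++ downWord n (n - 1) (k + 1)), R, ?_⟩
        rw [hT, downWord_succ_right (a := k) (by omega) (by omega)]; simp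
      · subst h3
        refine ih (k := k - 1) (R := R) (by omega) (by omega) ?_
        rw [hT, downWord_succ_right (a := k - 1) (by omega) (by omega),
          show k - 1 + 1 = k by omega]
        simp
      · have hs := downWord_split (n := n) (a := k) (k := t) (b := n - 1) (by omega) (by omega)
          (by omega)
        exact absurd (h.mem_between_letter ht (u := downWord n (t - 1) k)
          (letter n n :: (upWord n 1 j ++ downWord n (n - 1) (t + 1))) R (by rw [hT, hs]; simp)
          (letter_not_mem_downWord (by omega) (by omega) (by omega))).2
          (letter_not_mem_downWord (by omega) (by omega) (by omega))
    · rw [h1] at hT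
      rcases Nat.eq_zero_or_pos j with rfl | hj0
      · have h2 := (h.mem_between_letter (t := n) (by omega) (u := downWord n (n - 1) k) [] R
          (by rw [hT, upWord_of_lt (by omega)]; simp)
          (letter_not_mem_downWord (by omega) (by omega) (by omega))).2
        rw [← letter_add_one, ← letter_zero, letter_add_one] at h2
        exact absurd h2 (letter_not_mem_downWord (by omega) (by omega) (by omega))
      · exact ⟨k, _, by omega, hkn, hT, .inr (.inr ⟨hj0, R, rfl⟩)⟩

/-- The shape of a reduced word after an occurrence of `x_n`. -/
theorem IsReducedWord.exists_block (hn : 3 ≤ n) {T : CWord n}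
    (h : IsReducedWord (letter n n :: T)) : ∃ j k R, j + 2 ≤ n ∧ j < k ∧ k ≤ n ∧
      T = upWord n 1 j ++ (downWord n (n - 1) k ++ R) ∧
      (k = j + 1 ∨ R = [] ∨ (1 ≤ j ∧ k < n) ∧ ∃ R', R = letter n n :: R') := by
  obtain ⟨j, R, hj, hT, rfl | ⟨R', rfl⟩⟩ := h.exists_upWord hn (n - 2) (j := 0) (R := T)
    (by omega) (by rw [upWord_of_lt (by omega)]; simp)
  · exact ⟨j, n, [], hj, by omega, le_rfl, by rw [hT, downWord_of_lt (by omega)]; simp,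
      .inr (.inl rfl)⟩
  · obtain ⟨k, R, hk, hkn, hT', h'⟩ := h.exists_downWord hn (j := j) (n - 2 - j) (k := n - 1)
      (R := R') (by omega) (by omega) (by
        rw [hT, downWord_succ_right (a := n - 1) le_rfl (by omega), downWord_of_lt (by omega)]
        simp)
    refine ⟨j, k, R, hj, hk, hkn.le, hT', ?_⟩
    rcases h' with h1 | h1 | ⟨h1, h2⟩
    · exact .inl h1
    · exact .inr (.inl h1)
    · exact .inr (.inr ⟨⟨h1, hkn⟩, h2⟩)

/-- A letter missing between the two branches of a block never occurs further right. -/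
theorem IsReducedWord.not_mem_of_gap (hn : 3 ≤ n) {j k : ℕ} {R : CWord n}
    (h : IsReducedWord (letter n n :: (upWord n 1 j ++ (downWord n (n - 1) k ++ R))))
    (hjk : j + 2 ≤ k)
    (hR : R = [] ∨ (1 ≤ j ∧ k < n) ∧ ∃ R', R = letter n n :: R') {t : ℕ} (ht : j < t)
    (ht' : t < k) : letter n t ∉ R := by
  rcases hR with rfl | ⟨⟨hj, hkn⟩, R', rfl⟩
  · simp
  have hred : IsReducedWord (letter n n :: R') := h.of_isInfix
    ⟨letter n n :: (upWord n 1 j ++ downWord n (n - 1) k), [], by simp⟩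
  obtain ⟨j', k', R'', hj', hjk', hk', rfl, hR''⟩ := hred.exists_block hn
  -- The next block is strictly nested: with `j' ≥ j` two successive `x_j` would have no `x_{j+1}`
  -- between them, and with `k' ≤ k` two successive `x_k` no `x_{k-1}`. The gap therefore only
  -- widens.
  have hjj : j' < j := by
    by_contra! hle
    have hs := upWord_split (n := n) (a := 1) (k := j) (b := j) hj le_rfl le_rfl
    have hs' := upWord_split (n := n) (a := 1) (k := j) (b := j') hj hle le_rfl
    rw [upWord_of_lt (a := j + 1) (by omega)] at hs
    have h1 := h.mem_between_letter hj
      (u := downWord n (n - 1) k ++ letter n n :: upWord n 1 (j - 1))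
      (letter n n :: upWord n 1 (j - 1))
      (upWord n (j + 1) j' ++ (downWord n (n - 1) k' ++ R'')) (by rw [hs, hs']; simp) (by
        simp only [List.mem_append, List.mem_cons, not_or]
        exact ⟨letter_not_mem_downWord (by omega) (by omega) (by omega),
          letter_ne_of_lt (by omega) (by omega),
          letter_not_mem_upWord (by omega) (by omega) (by omega)⟩)
    have h2 := h1.2
    simp only [List.mem_append, List.mem_cons] at h2
    rcases h2 with h2 | h2 | h2
    · exact letter_not_mem_downWord (by omega) (by omega) (by omega) h2
    · exact letter_ne_of_lt (by omega) (by omega) h2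
    · exact letter_not_mem_upWord (by omega) (by omega) (by omega) h2
  have hkk : k < k' := by
    by_contra! hle
    have hs := downWord_succ_right (n := n) (a := k) (b := n - 1) (by omega) (by omega)
    have hs' := downWord_split (n := n) (a := k') (k := k) (b := n - 1) hle (by omega) (by omega)
    have h1 := h.mem_between_letter (t := k) (by omega)
      (u := letter n n :: (upWord n 1 j' ++ downWord n (n - 1) (k + 1)))
      (letter n n :: (upWord n 1 j ++ downWord n (n - 1) (k + 1)))
      (downWord n (k - 1) k' ++ R'') (by rw [hs, hs']; simp) (by
        simp only [List.mem_append, List.mem_cons, not_or]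
        exact ⟨letter_ne_of_lt (by omega) (by omega),
          letter_not_mem_upWord (by omega) (by omega) (by omega),
          letter_not_mem_downWord (by omega) (by omega) (by omega)⟩)
    have h2 := h1.1
    simp only [List.mem_append, List.mem_cons] at h2
    rcases h2 with h2 | h2 | h2
    · exact letter_ne_of_lt (by omega) (by omega) h2
    · exact letter_not_mem_upWord (by omega) (by omega) (by omega) h2
    · exact letter_not_mem_downWord (by omega) (by omega) (by omega) h2
  have ih := IsReducedWord.not_mem_of_gap hn hred (by omega)
    (hR''.resolve_left (by omega)) (t := t) (by omega) (by omega)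
  simp only [List.mem_append, List.mem_cons, not_or]
  exact ⟨letter_ne_of_lt (by omega) (by omega),
    letter_not_mem_upWord (by omega) (by omega) (by omega),
    letter_not_mem_downWord (by omega) (by omega) (by omega), ih⟩
termination_by R.length
decreasing_by subst_vars; simp; omega

/-- If all letters occur to the right of an occurrence of `x_n` in a reduced word, then this
occurrence is the beginning of a factor `x_n q_j`. -/
theorem IsReducedWord.exists_xqWord (hn : 3 ≤ n) {v : CWord n}
    (h : IsReducedWord (letter n n :: v)) (hv : ∀ t, 1 ≤ t → t < n → letter n t ∈ v) :
    ∃ j R, j + 2 ≤ n ∧ letter n n :: v = xqWord n j ++ R := by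
  obtain ⟨j, k, R, hj, hjk, hk, rfl, hR⟩ := h.exists_block hn
  by_cases hgap : k = j + 1
  · exact ⟨j, R, hj, by simp [xqWord, hgap]⟩
  · exfalso
    have h1 := h.not_mem_of_gap hn (by omega) (hR.resolve_left hgap) (t := j + 1) (by omega)
      (by omega)
    have h2 := hv (j + 1) (by omega) (by omega)
    simp only [List.mem_append] at h2
    rcases h2 with h2 | h2 | h2
    · exact letter_not_mem_upWord (by omega) (by omega) (by omega) h2
    · exact letter_not_mem_downWord (by omega) (by omega) (by omega) h2
    · exact h1 h2

end Blocks

/-! ### Counting residues -/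

section Count
variable {n : ℕ}

/-- Core letters lie on `x_n` or the descending branch, hence precede their lower neighbours. This
is the position required by `IsAlternating.exists_act_eq` and `IsAlternating.act_lt_act`. -/
theorem exists_xqWord_split {j : ℕ} {c : ZMod n} (hc : c ∈ core n j) :
    ∃ s s', xqWord n j = s ++ c :: s' ∧ c ∉ s ∧ c - 1 ∉ s := by
  obtain ⟨t, ht, ht', rfl⟩ := hc
  rcases ht'.lt_or_eq with h | rfl
  · refine ⟨letter n n :: (upWord n 1 j ++ downWord n (n - 1) (t + 1)), downWord n (t - 1) (j + 1),
      ?_, ?_, ?_⟩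
    · rw [xqWord, downWord_split (k := t) (by omega) (by omega) (by omega)]; simp
    · simp only [List.mem_append, List.mem_cons, not_or]
      exact ⟨letter_ne_of_lt (by omega) (by omega),
        letter_not_mem_upWord (by omega) (by omega) (by omega),
        letter_not_mem_downWord (by omega) (by omega) (by omega)⟩
    · rw [letter_sub_one (by omega)]
      simp only [List.mem_append, List.mem_cons, not_or]
      exact ⟨letter_ne_of_lt (by omega) (by omega),
        letter_not_mem_upWord (by omega) (by omega) (by omega),
        letter_not_mem_downWord (by omega) (by omega) (by omega)⟩
  · exact ⟨[], _, rfl, by simp, by simp⟩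

/-- Alternation makes `x_n q_j R` onto the core and `u` strictly increasing from each core point, so
no rank is lost on either side. -/
theorem IsAlternating.ncard_residues (hn : 3 ≤ n) {j : ℕ} (hj : j + 2 ≤ n) {u R : CWord n}
    (h : IsAlternating (u ++ (xqWord n j ++ R))) :
    (residues (u ++ (xqWord n j ++ R))).ncard = n - 1 - j := by
  have himage : residues (xqWord n j ++ R) = core n j := by
    refine (residues_xqWord_append_subset hn hj R).antisymm fun c hc => ?_
    obtain ⟨s, s', e, -, hs⟩ := exists_xqWord_split hc
    obtain ⟨m, rfl⟩ := ZMod.intCast_surjective c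
    obtain ⟨p, hp⟩ := IsAlternating.exists_act_eq hn (u := s) (v := s' ++ R) (s := m)
      (by have := h.right; rw [e] at this; simpa using this) hs
    exact ⟨p, by rw [e]; simp only [List.append_assoc, List.cons_append, hp]⟩
  have hlt : ∀ m q : ℤ, (m : ZMod n) ∈ core n j → m < q → act u m < act u q := by
    intro m q hm hq
    obtain ⟨s, s', e, hs, hs'⟩ := exists_xqWord_split hm
    exact IsAlternating.act_lt_act (v := s) (h.of_isInfix ⟨[], s' ++ R, by simp [e]⟩) hs hs' hq
  rw [residues_append, himage, Set.InjOn.ncard_image, ncard_core hj]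
  intro c hc c' hc' e
  obtain ⟨m, rfl⟩ := ZMod.intCast_surjective c
  obtain ⟨m', rfl⟩ := ZMod.intCast_surjective c'
  rw [resAct_intCast, resAct_intCast] at e
  obtain ⟨t, ht⟩ := intCast_eq_intCast_iff_exists.1 e
  rw [← act_add_mul] at ht
  rcases lt_trichotomy m' (m + n * t) with h1 | rfl | h1
  · exact absurd ht (hlt _ _ hc' h1).ne
  · simp
  · exact absurd ht (hlt _ _ (by rwa [intCast_add_mul]) h1).ne.symm

/-- Outside the ideal, the reduced words of the elements of `C_n (x_n q_i) C_n` have the factor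
`x_n q_i`. -/
theorem mem_Mtilde (hn : 3 ≤ n) {i : ℕ} (hi : i + 2 ≤ n) (a b : CycleMonoid n)
    (h : a * xq n i * b ∉ idealI n i) : a * xq n i * b ∈ Mtilde n i := by
  obtain ⟨a, rfl⟩ := toMonoid_surjective a
  obtain ⟨b, rfl⟩ := toMonoid_surjective b
  have e : a.toMonoid * xq n i * b.toMonoid = CWord.toMonoid (a ++ (xqWord n i ++ b)) := by
    rw [toMonoid_append, toMonoid_append, ← mul_assoc, xq]
  rw [e] at h ⊢
  obtain ⟨w, hw, hwe⟩ := exists_reducedWord hn (CWord.toMonoid (a ++ (xqWord n i ++ b)))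
  obtain ⟨u, v, rfl, hv⟩ := exists_split_letter_mem hn hi hwe (hwe ▸ h)
  obtain ⟨j, R, hj, hR⟩ := (hw.of_isInfix (List.suffix_append _ _).isInfix).exists_xqWord hn hv
  have h1 := hw.isAlternating
  rw [hR] at h1 hw hwe
  have h2 : residues (u ++ (xqWord n j ++ R)) = residues (a ++ (xqWord n i ++ b)) := by
    simp only [residues, act_eq_of_toMonoid_eq hn hwe]
  have h3 := h1.ncard_residues hn hj
  have h4 := le_ncard_residues hn hi h
  have h5 := ncard_residues_append_le hn a (xqWord n i ++ b)
  have : NeZero n := ⟨by omega⟩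
  have h6 := Set.ncard_le_ncard (residues_xqWord_append_subset hn hi b) (Set.toFinite _)
  rw [ncard_core hi] at h6
  -- Both `n - 1 - j` and `n - 1 - i` equal the rank of the same element.
  obtain rfl : j = i := by rw [h2] at h3; omega
  exact ⟨_, hw, ⟨u, R, by simp⟩, hwe⟩

theorem mul_mem_Mtilde (hn : 3 ≤ n) {i : ℕ} (hi : i + 2 ≤ n) {u : CycleMonoid n}
    (hu : u ∈ Mtilde n i) (v : CycleMonoid n) (h : u * v ∉ idealI n i) : u * v ∈ Mtilde n i := by
  obtain ⟨w, -, ⟨x, y, rfl⟩, rfl⟩ := hu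
  have e : CWord.toMonoid (x ++ xqWord n i ++ y) * v
      = CWord.toMonoid x * xq n i * (CWord.toMonoid y * v) := by
    simp only [toMonoid_append, xq, mul_assoc]
  rw [e] at h ⊢
  exact mem_Mtilde hn hi _ _ h

theorem mul_mem_idealI {i : ℕ} {w : CycleMonoid n} (h : w ∈ idealI n i) (a b : CycleMonoid n) :
    a * w * b ∈ idealI n i := by
  rw [idealI, Set.mem_ofPred_eq, Set.eq_empty_iff_forall_notMem] at h ⊢
  rintro z ⟨⟨c, d, rfl⟩, hz⟩
  exact h _ ⟨⟨c * a, b * d, by simp only [mul_assoc]⟩, hz⟩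

theorem mul_right_mem_idealI {i : ℕ} {w : CycleMonoid n} (h : w ∈ idealI n i)
    (b : CycleMonoid n) : w * b ∈ idealI n i := by
  simpa using mul_mem_idealI h 1 b

theorem mul_left_mem_idealI {i : ℕ} {w : CycleMonoid n} (h : w ∈ idealI n i)
    (a : CycleMonoid n) : a * w ∈ idealI n i := by
  simpa using mul_mem_idealI h a 1

end Count

/-! ### The factor semigroup -/

section Factor
variable {n : ℕ}

theorem MtildeTheta.eq_zero_or_coe {i : ℕ} (s : MtildeTheta n i) :
    s = 0 ∨ ∃ u : Mtilde n i, s = (u : MtildeTheta n i) := by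
  cases s using WithZero.recZeroCoe with
  | zero => exact .inl rfl
  | coe u => exact .inr ⟨u, rfl⟩

theorem IsFactorMul.unique {i : ℕ} {m m' : MtildeTheta n i → MtildeTheta n i → MtildeTheta n i}
    (h : IsFactorMul n i m) (h' : IsFactorMul n i m') : m = m' := by
  funext s t
  rcases s.eq_zero_or_coe with rfl | ⟨u, rfl⟩
  · rw [h.zero_mul, h'.zero_mul]
  rcases t.eq_zero_or_coe with rfl | ⟨v, rfl⟩
  · rw [h.mul_zero, h'.mul_zero]
  by_cases huv : (u * v : CycleMonoid n) ∈ idealI n i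
  · rw [h.mul_mem_ideal u v huv, h'.mul_mem_ideal u v huv]
  · obtain ⟨_, e⟩ := h.mul_notMem_ideal u v huv
    obtain ⟨_, e'⟩ := h'.mul_notMem_ideal u v huv
    rw [e, e']

open Classical in
theorem exists_isFactorMul (hn : 3 ≤ n) {i : ℕ} (hi : i + 2 ≤ n) :
    ∃ m : MtildeTheta n i → MtildeTheta n i → MtildeTheta n i, IsFactorMul n i m := by
  let f : Mtilde n i → Mtilde n i → MtildeTheta n i := fun u v =>
    if h : (u * v : CycleMonoid n) ∈ idealI n i then 0
    else ((⟨(u * v : CycleMonoid n), mul_mem_Mtilde hn hi u.2 v h⟩ : Mtilde n i) :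
      MtildeTheta n i)
  refine ⟨fun s t => WithZero.recZeroCoe 0 (fun u => WithZero.recZeroCoe 0 (f u) t) s,
    ⟨fun s => rfl, fun s => ?_, fun u v h => ?_, fun u v h => ?_⟩⟩
  · rcases s.eq_zero_or_coe with rfl | ⟨u, rfl⟩ <;> rfl
  · exact dif_pos h
  · exact ⟨mul_mem_Mtilde hn hi u.2 v h, dif_neg h⟩

theorem IsFactorMul.assoc {i : ℕ} {m : MtildeTheta n i → MtildeTheta n i → MtildeTheta n i}
    (h : IsFactorMul n i m) (r s t : MtildeTheta n i) : m (m r s) t = m r (m s t) := by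
  rcases r.eq_zero_or_coe with rfl | ⟨u, rfl⟩
  · simp only [h.zero_mul]
  rcases s.eq_zero_or_coe with rfl | ⟨v, rfl⟩
  · simp only [h.zero_mul, h.mul_zero]
  rcases t.eq_zero_or_coe with rfl | ⟨w, rfl⟩
  · simp only [h.mul_zero]
  by_cases huv : (u * v : CycleMonoid n) ∈ idealI n i
  · rw [h.mul_mem_ideal u v huv, h.zero_mul]
    by_cases hvw : (v * w : CycleMonoid n) ∈ idealI n i
    · rw [h.mul_mem_ideal v w hvw, h.mul_zero]
    · obtain ⟨h1, e1⟩ := h.mul_notMem_ideal v w hvw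
      rw [e1, h.mul_mem_ideal]
      rw [← mul_assoc]
      exact mul_right_mem_idealI huv _
  · obtain ⟨h1, e1⟩ := h.mul_notMem_ideal u v huv
    rw [e1]
    by_cases hvw : (v * w : CycleMonoid n) ∈ idealI n i
    · rw [h.mul_mem_ideal v w hvw, h.mul_zero, h.mul_mem_ideal]
      rw [mul_assoc]
      exact mul_left_mem_idealI hvw _
    · obtain ⟨h2, e2⟩ := h.mul_notMem_ideal v w hvw
      rw [e2]
      by_cases huvw : (u * v * w : CycleMonoid n) ∈ idealI n i
      · rw [h.mul_mem_ideal _ _ huvw, h.mul_mem_ideal]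
        rwa [← mul_assoc]
      · obtain ⟨h3, e3⟩ := h.mul_notMem_ideal ⟨_, h1⟩ w huvw
        obtain ⟨h4, e4⟩ := h.mul_notMem_ideal u ⟨_, h2⟩ (by rwa [← mul_assoc])
        rw [e3, e4]
        simp only [mul_assoc]

end Factor

theorem theorem3p10 (n : ℕ) (hn : 3 ≤ n) (i : ℕ) (hi : i ≤ n - 2) :
    (∀ w : CycleMonoid n,
      xq n i * w * xq n i ∈ {z | ∃ k : ℕ, 2 ≤ k ∧ z = xq n i ^ k} ∪ idealI n i) ∧
    (∃! mul : MtildeTheta n i → MtildeTheta n i → MtildeTheta n i, IsFactorMul n i mul) ∧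
    (∀ mul : MtildeTheta n i → MtildeTheta n i → MtildeTheta n i, IsFactorMul n i mul →
      ∀ r s t, mul (mul r s) t = mul r (mul s t)) := by
  have hi' : i + 2 ≤ n := by omega
  refine ⟨fun w => ?_, ?_, fun mul h => h.assoc⟩
  · by_cases h : xq n i * w * xq n i ∈ idealI n i
    · exact .inr h
    · exact .inl (sandwich hn hi' w h)
  · obtain ⟨m, hm⟩ := exists_isFactorMul hn hi'
    exact ⟨m, hm, fun m' hm' => hm'.unique hm⟩
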